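/- Let $R$ be a complete admissible ring, i.e. a one-dimensional, Noetherian, local, Cohen--Macaulay, analytically reduced and residually rational ring (every residue field of the integral closure of $R$ in its total ring of fractions $K$ equals the residue field of $R$), complete in the topology of its maximal ideal, whose residue field has at least $r$ elements, where $\wp_1,\dots,\wp_r$ ($r\ge 1$) are the minimal primes of $R$. Put $I=\{1,\dots,r\}$ and $I'=\{1,\dots,r-1\}$. For $J\subseteq I$ let $R_J=R/\bigcap_{j\in J}\wp_j$, let $K_J$ be its total ring of fractions, and let $\pi_J\colon K\to K_J$ be the natural projection (for $J=\emptyset$ these are zero rings). For $i\in I$ the integral closure of $R/\wp_i$ in its field of fractions $K_i$ is a discrete valuation ring; let $v_i$ be its normalized valuation, with $v_i(0)=\infty$, and for $h\in K_J$ and $j\in J$ write $v_j(h)$ for the value of the image of $h$ in $K_j$. Let $\mathcal I$ be a regular fractional ideal of $R$, i.e. an $R$-submodule of $K$ containing a regular element of $R$ with $d\,\mathcal I\subseteq R$ for some regular $d\in R$. Let $E\subseteq\mathbb Z^r$ be its value set, the set of all $(v_1(h),\dots,v_r(h))$ with $h\in\mathcal I$ not a zero divisor of $K$, and for $\emptyset\ne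 J\subseteq I$ let $E_J\subseteq\mathbb Z^J$ be the set of all $(v_j(h))_{j\in J}$ with $h\in\pi_J(\mathcal I)$ not a zero divisor of $K_J$; write $E_r=E_{\{r\}}\subseteq\mathbb Z$. For $\gamma\in\mathbb Z^r$ and $\delta\in\mathbb Z^{I'}$ put $$\mathcal I(\gamma)=\{h\in\mathcal I:\ v_i(h)\ge\gamma_i\ \ \forall i\in I\},\qquad \pi_{I'}(\mathcal I)(\delta)=\{h\in\pi_{I'}(\mathcal I):\ v_i(h)\ge\delta_i\ \ \forall i\in I'\}.$$ Let $\mathcal L(E_r)=\{x\in\mathbb Z:\ x>\min E_r,\ x\notin E_r\}$. For $A\subseteq\mathbb Z^J$, $\alpha\in\mathbb Z^J$ and $\emptyset\neq T\subseteq J$ let $F_T(A,\alpha)$ be the set of $\beta\in A$ with $\beta_t=\alpha_t$ for $t\in T$ and $\beta_t>\alpha_t$ for $t\in J\setminus T$. A relative maximal of $A$ is a point $\alpha\in A$ with $F_{\{i\}}(A,\alpha)=\emptyset$ for all $i\in J$ and $F_T(A,\alpha)\ne\emptyset$ for all $T\subseteq J$ with $\#T\ge2$; $RM(A)$ denotes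 the set of these points. Then, in the product order of $\mathbb Z^r$, $E$ has a least element $\alpha^0$, and there is a least element $c(E)$ among the $\delta\in E$ with $\delta+\mathbb N^r\subseteq E$. For every $\gamma\in\mathbb Z^r$ with $\gamma\ge c(E)$, all the quantities below are finite, and, with $\ell$ the length of $R$-modules, $$\ell\left(\frac{\mathcal I}{\mathcal I(\gamma)}\right)=\ell\left(\frac{\pi_{I'}(\mathcal I)}{\pi_{I'}(\mathcal I)(\gamma_1,\dots,\gamma_{r-1})}\right)+(\gamma_r-\alpha^0_r)-\#\mathcal L(E_r)-\#\left(\bigcup_{\{r\}\subsetneq J\subseteq I}\{\beta_r:\ \beta\in RM(E_J)\}\right).$$ -/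

import Mathlib

open scoped nonZeroDivisors WithZero

namespace Colength

universe u

/-- Complete admissible rings: one-dimensional, Noetherian, local, Cohen-Macaulay, analytically
reduced, residually rational rings with sufficiently large residue field which are complete for
the topology of the maximal ideal. -/
structure IsCompleteAdmissible (R : Type u) [CommRing R] [IsLocalRing R] : Prop where
  noetherian : IsNoetherianRing R
  dim_one : ringKrullDim R = 1
  complete : IsAdicComplete (IsLocalRing.maximalIdeal R) R
  /-- For a one-dimensional Noetherian local ring, depth equals dimension exactly when the
  maximal ideal contains a regular element. -/
  cohenMacaulay : ∃ x ∈ IsLocalRing.maximalIdeal R, x ∈ R⁰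
  analyticallyReduced : IsReduced (AdicCompletion (IsLocalRing.maximalIdeal R) R)
  /-- The residue fields of the integral closure of `R` in its total ring of fractions are all
  equal to the residue field of `R`. -/
  residuallyRational : ∀ n : Ideal (integralClosure R (FractionRing R)), n.IsMaximal →
    Function.Surjective (algebraMap R (integralClosure R (FractionRing R) ⧸ n))
  largeResidueField : (minimalPrimes R).encard ≤ ENat.card (IsLocalRing.ResidueField R)

section Valuation

/-- For a domain `A` whose integral closure in its field of fractions is a discrete valuation
ring, the normalized valuation of that ring, written multiplicatively: `exp (-n)` is the value of
an element of order `n`, and `0` is the value of `0`. (When the integral closure is not a discrete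
valuation ring, the value is a dummy.) -/
noncomputable def normVal (A : Type u) [CommRing A] [IsDomain A] :
    Valuation (FractionRing A) ℤᵐ⁰ :=
  open Classical in
  if _h : IsDiscreteValuationRing (integralClosure A (FractionRing A)) then
    haveI : IsFractionRing (integralClosure A (FractionRing A)) (FractionRing A) :=
      integralClosure.isFractionRing_of_finite_extension (FractionRing A) (FractionRing A)
    (IsDiscreteValuationRing.maximalIdeal
      (integralClosure A (FractionRing A))).valuation (FractionRing A)
  else 1

theorem normVal_algebraMap_le_one (A : Type u) [CommRing A] [IsDomain A] (a : A) :
    normVal A (algebraMap A (FractionRing A) a) ≤ 1 := by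
  classical
  unfold normVal
  split_ifs with h
  · have : IsFractionRing (integralClosure A (FractionRing A)) (FractionRing A) :=
      integralClosure.isFractionRing_of_finite_extension (FractionRing A) (FractionRing A)
    rw [IsScalarTower.algebraMap_apply A (integralClosure A (FractionRing A)) (FractionRing A)]
    exact IsDedekindDomain.HeightOneSpectrum.valuation_le_one _ _
  · exact Valuation.one_apply_le_one (Γ₀ := ℤᵐ⁰) _

end Valuation

section Branches

variable {R : Type u} [CommRing R] {r : ℕ} (P : Fin r ≃ minimalPrimes R)

instance (i : Fin r) : (P i).1.IsPrime := (P i).2.1.1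

/-- `R_i = R / ℘_i`. -/
abbrev BranchRing (i : Fin r) : Type u := R ⧸ (P i).1

/-- `K_i`, the field of fractions of `R_i`. -/
abbrev BranchField (i : Fin r) : Type u := FractionRing (BranchRing P i)

/-- `⋂_{j ∈ J} ℘_j`. -/
abbrev interIdeal (J : Finset (Fin r)) : Ideal R := ⨅ j ∈ J, (P j).1

/-- `R_J = R / ⋂_{j ∈ J} ℘_j`. -/
abbrev PartialRing (J : Finset (Fin r)) : Type u := R ⧸ interIdeal P J

/-- `K_J`, the total ring of fractions of `R_J`. -/
abbrev PartialFrac (J : Finset (Fin r)) : Type u := FractionRing (PartialRing P J)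

theorem interIdeal_le {J : Finset (Fin r)} {j : Fin r} (hj : j ∈ J) :
    interIdeal P J ≤ (P j).1 := iInf₂_le j hj

theorem regular_notMem (i : Fin r) {x : R} (hx : x ∈ R⁰) : x ∉ (P i).1 := fun h =>
  Set.disjoint_left.mp (Ideal.disjoint_nonZeroDivisors_of_mem_minimalPrimes (P i).2) h hx

theorem regular_le_comap_branch (i : Fin r) :
    R⁰ ≤ (BranchRing P i)⁰.comap (Ideal.Quotient.mk (P i).1) := by
  intro x hx
  rw [Submonoid.mem_comap, mem_nonZeroDivisors_iff_ne_zero, Ne, Ideal.Quotient.eq_zero_iff_mem]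
  exact regular_notMem P i hx

theorem regular_le_comap_partial (J : Finset (Fin r)) :
    R⁰ ≤ (PartialRing P J)⁰.comap (Ideal.Quotient.mk (interIdeal P J)) := by
  intro x hx
  rw [Submonoid.mem_comap, mem_nonZeroDivisors_iff_right]
  intro y
  obtain ⟨y, rfl⟩ := Ideal.Quotient.mk_surjective y
  rw [← map_mul, Ideal.Quotient.eq_zero_iff_mem, Ideal.Quotient.eq_zero_iff_mem]
  simp only [Submodule.mem_iInf]
  intro h j hj
  exact ((P j).2.1.1.mem_or_mem (h j hj)).resolve_right (regular_notMem P j hx)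

theorem partial_regular_le_comap_branch (J : Finset (Fin r)) (j : J) :
    (PartialRing P J)⁰ ≤
      (BranchRing P j)⁰.comap (Ideal.Quotient.factor (interIdeal_le P j.2)) := by
  intro x hx
  obtain ⟨x, rfl⟩ := Ideal.Quotient.mk_surjective x
  rw [Submonoid.mem_comap, mem_nonZeroDivisors_iff_ne_zero, Ideal.Quotient.factor_mk, Ne,
    Ideal.Quotient.eq_zero_iff_mem]
  intro hxj
  have hmin : (P j).1 ∈ (interIdeal P J).minimalPrimes :=
    ⟨⟨(P j).2.1.1, interIdeal_le P j.2⟩, fun q hq hle => (P j).2.2 ⟨hq.1, bot_le⟩ hle⟩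
  obtain ⟨y, hy, hxy⟩ := Ideal.exists_mul_mem_of_mem_minimalPrimes hmin hxj
  apply hy
  rw [← Ideal.Quotient.eq_zero_iff_mem] at hxy ⊢
  rw [map_mul] at hxy
  exact (mem_nonZeroDivisors_iff.mp hx).1 _ hxy

/-- The projection `π_i : K → K_i` extending `R → R_i`. -/
noncomputable def projBranch (i : Fin r) : FractionRing R →+* BranchField P i :=
  IsLocalization.map (BranchField P i) (Ideal.Quotient.mk (P i).1) (regular_le_comap_branch P i)

/-- The projection `π_J : K → K_J` extending `R → R_J`. -/
noncomputable def projPartialHom (J : Finset (Fin r)) : FractionRing R →+* PartialFrac P J :=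
  IsLocalization.map (PartialFrac P J) (Ideal.Quotient.mk (interIdeal P J))
    (regular_le_comap_partial P J)

/-- The projection `K_J → K_j` extending `R_J → R_j`, for `j ∈ J`. -/
noncomputable def projPartialBranch (J : Finset (Fin r)) (j : J) :
    PartialFrac P J →+* BranchField P j :=
  IsLocalization.map (BranchField P j) (Ideal.Quotient.factor (interIdeal_le P j.2))
    (partial_regular_le_comap_branch P J j)

/-- `π_J : K → K_J` as an `R`-linear map. -/
noncomputable def projPartial (J : Finset (Fin r)) : FractionRing R →ₗ[R] PartialFrac P J :=
  AlgHom.toLinearMap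
    { projPartialHom P J with
      commutes' := fun a => by
        change projPartialHom P J (algebraMap R (FractionRing R) a) = _
        rw [projPartialHom, IsLocalization.map_eq]
        rfl }

/-- `h ↦ v_i (π_i h)` on `K`. -/
noncomputable def val (i : Fin r) : Valuation (FractionRing R) ℤᵐ⁰ :=
  (normVal (BranchRing P i)).comap (projBranch P i)

/-- `h ↦ v_j (π_j h)` on `K_J`, for `j ∈ J`. -/
noncomputable def partialVal (J : Finset (Fin r)) (j : J) : Valuation (PartialFrac P J) ℤᵐ⁰ :=
  (normVal (BranchRing P j)).comap (projPartialBranch P J j)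

theorem val_algebraMap_le_one (i : Fin r) (a : R) :
    val P i (algebraMap R (FractionRing R) a) ≤ 1 := by
  rw [val, Valuation.comap_apply, projBranch, IsLocalization.map_eq]
  exact normVal_algebraMap_le_one _ _

theorem partialVal_algebraMap_le_one (J : Finset (Fin r)) (j : J) (a : R) :
    partialVal P J j (algebraMap R (PartialFrac P J) a) ≤ 1 := by
  rw [IsScalarTower.algebraMap_apply R (PartialRing P J) (PartialFrac P J),
    partialVal, Valuation.comap_apply, projPartialBranch, IsLocalization.map_eq]
  exact normVal_algebraMap_le_one _ _

end Branches

section ValueSets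

variable {R : Type u} [CommRing R] {L : Type u} [CommRing L] [Algebra R L] {ι : Type}

/-- The value set of an `R`-submodule `M` of `L` with respect to a family `w` of valuations:
the vectors of orders of the elements of `M` that are not zero divisors of `L`. The order of an
element `h` for the (multiplicatively written) valuation `w i` is `-log (w i h)`. -/
def valueSet (w : ι → Valuation L ℤᵐ⁰) (M : Submodule R L) : Set (ι → ℤ) :=
  {α | ∃ h ∈ M, h ∈ L⁰ ∧ ∀ i, α i = -WithZero.log (w i h)}

/-- `M(γ)`: the elements of `M` whose order is at least `γ i` for every `i`, where an element with
zero image in the `i`-th branch has order `∞` there. -/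
def truncation (w : ι → Valuation L ℤᵐ⁰) (hw : ∀ i (a : R), w i (algebraMap R L a) ≤ 1)
    (M : Submodule R L) (γ : ι → ℤ) : Submodule R L where
  carrier := {h | h ∈ M ∧ ∀ i, w i h ≤ WithZero.exp (-γ i)}
  zero_mem' := ⟨M.zero_mem, fun i => by simp⟩
  add_mem' := fun ha hb =>
    ⟨M.add_mem ha.1 hb.1, fun i => (w i).map_add_le (ha.2 i) (hb.2 i)⟩
  smul_mem' := fun a h hh => ⟨M.smul_mem a hh.1, fun i => by
    rw [Algebra.smul_def, map_mul]
    exact (mul_le_of_le_one_left' (hw i a)).trans (hh.2 i)⟩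

end ValueSets

section Ideals

variable {R : Type u} [CommRing R] {r : ℕ} (P : Fin r ≃ minimalPrimes R)
  (M : FractionalIdeal R⁰ (FractionRing R))

/-- The value set `E` of a fractional ideal. -/
def idealValueSet : Set (Fin r → ℤ) :=
  valueSet (val P) (M : Submodule R (FractionRing R))

/-- `π_J` of a fractional ideal. -/
noncomputable def projIdeal (J : Finset (Fin r)) : Submodule R (PartialFrac P J) :=
  (M : Submodule R (FractionRing R)).map (projPartial P J)

/-- `E_J`, the value set of `π_J` of a fractional ideal. -/
def projValueSet (J : Finset (Fin r)) : Set (J → ℤ) :=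
  valueSet (partialVal P J) (projIdeal P M J)

/-- `ℓ_R (𝓘 / 𝓘(γ))`. -/
noncomputable def colength (γ : Fin r → ℤ) : ℕ∞ :=
  Module.length R ((M : Submodule R (FractionRing R)) ⧸
    (truncation (val P) (val_algebraMap_le_one P) (M : Submodule R (FractionRing R)) γ).submoduleOf
      (M : Submodule R (FractionRing R)))

/-- `ℓ_R (π_J(𝓘) / π_J(𝓘)(δ))`. -/
noncomputable def projColength (J : Finset (Fin r)) (δ : J → ℤ) : ℕ∞ :=
  Module.length R (projIdeal P M J ⧸
    (truncation (partialVal P J) (partialVal_algebraMap_le_one P J)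
      (projIdeal P M J) δ).submoduleOf (projIdeal P M J))

/-- `E_i` for a single index `i`, as a set of integers. -/
def branchValueSet (i : Fin r) : Set ℤ :=
  (fun β : ({i} : Finset (Fin r)) → ℤ => β ⟨i, Finset.mem_singleton_self i⟩) ''
    projValueSet P M {i}

end Ideals

section Combinatorics

variable {ι : Type}

/-- `c` is the conductor of `E`: the least element `c` of `E` with `c + ℕ^ι ⊆ E`. -/
def IsConductor (E : Set (ι → ℤ)) (c : ι → ℤ) : Prop :=
  IsLeast {δ | δ ∈ E ∧ ∀ β, δ ≤ β → β ∈ E} c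

/-- The fiber `F_J(A, α)`. -/
def fiber (J : Finset ι) (A : Set (ι → ℤ)) (α : ι → ℤ) : Set (ι → ℤ) :=
  {β | β ∈ A ∧ (∀ j ∈ J, β j = α j) ∧ ∀ j ∉ J, α j < β j}

/-- Maximal points. -/
def IsMaximalPoint (A : Set (ι → ℤ)) (α : ι → ℤ) : Prop :=
  α ∈ A ∧ ∀ i, fiber {i} A α = ∅

/-- The set `RM(A)` of relative maximals. -/
def relMaximals (A : Set (ι → ℤ)) : Set (ι → ℤ) :=
  {α | IsMaximalPoint A α ∧ ∀ J : Finset ι, 2 ≤ J.card → (fiber J A α).Nonempty}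

/-- The gaps of a set of integers above its minimum. -/
def gaps (S : Set ℤ) : Set ℤ :=
  {x | (∃ y ∈ S, y < x) ∧ x ∉ S}

/-- The union over all `J` with `{i} ⊊ J` of the sets of `i`-th coordinates of the relative
maximals of `A J`. -/
def relMaximalCoords {r : ℕ} (A : ∀ J : Finset (Fin r), Set (J → ℤ)) (i : Fin r) : Set ℤ :=
  {x | ∃ (J : Finset (Fin r)) (hJ : {i} ⊂ J), ∃ β ∈ relMaximals (A J),
    x = β ⟨i, hJ.1 (Finset.mem_singleton_self i)⟩}

end Combinatorics

end Colength

/-!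
Let `S = E_r` be the set of orders at the last branch of the elements of `𝓘`, and let `X ⊆ S` be
the set of those attained by elements that vanish on all other branches. If `N` is the set of all
`h ∈ 𝓘` with `v_j(h) ≥ γ_j` for `j ≠ r`, then `𝓘 / N` is `π_{I'}(𝓘) / π_{I'}(𝓘)(γ)`, while
`N / 𝓘(γ)` is filtered by the order at the last branch, with simple factors by residual
rationality. As `γ` is at least the conductor, the part of an element of `N` on the other branches
already lies in `𝓘`, so the orders of `N` at the last branch are those in `X`, and the length of
`N / 𝓘(γ)` is the number of elements of `X` below `γ_r`. The interval `[α⁰_r, γ_r)` is the disjoint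
union of the gaps of `S`, of `S \ X` and of these elements of `X`.

It remains to see that `S \ X` consists of the last coordinates of the relative maximals. Given
`x ∈ S \ X`, choose lower bounds `δ_j` on the orders at the other branches that are minimal among
those that no element of order `x` at the last branch satisfies. Let `J` contain `r` and the
branches where `δ_j` exceeds a common lower bound of the orders of `𝓘`. Minimality yields, for each
`j ∈ J \ {r}`, an element with orders `x` at `r` and `δ_j - 1` at `j` and larger orders on the rest
of `J`; cancelling leading terms of two of these, and adding without cancellation, gives all the
fibres that make the point with coordinates `x` and `δ_j - 1` a relative maximal of `E_J`.
-/

namespace Colength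

open IsLocalRing

universe u

/-! ### Finite domains over a complete local ring -/

section Completeness

theorem isPrecomplete_of_finite {A : Type*} [CommRing A] (I : Ideal A) [IsPrecomplete I A]
    (N : Type*) [AddCommGroup N] [Module A N] [Module.Finite A N] : IsPrecomplete I N := by
  rw [← AdicCompletion.of_surjective_iff]
  intro y
  obtain ⟨t, rfl⟩ := AdicCompletion.ofTensorProduct_surjective_of_finite I N y
  induction t with
  | zero => exact ⟨0, by simp only [map_zero]⟩
  | tmul a m =>
    obtain ⟨a, rfl⟩ := AdicCompletion.of_surjective I A a
    exact ⟨a • m, by rw [AdicCompletion.ofTensorProduct_tmul, map_smul]; rfl⟩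
  | add s t hs ht =>
    obtain ⟨x, hx⟩ := hs
    obtain ⟨y, hy⟩ := ht
    exact ⟨x + y, by rw [map_add, map_add, hx, hy]⟩

theorem exists_fg_map_eq_of_surjective {A M N : Type*} [Ring A] [AddCommGroup M] [Module A M]
    [AddCommGroup N] [Module A N] {f : M →ₗ[A] N} (hf : Function.Surjective f)
    {F : Submodule A N} (hF : F.FG) : ∃ G : Submodule A M, G.FG ∧ G.map f = F := by
  obtain ⟨s, hs, rfl⟩ := Submodule.fg_def.mp hF
  refine ⟨Submodule.span A (Function.surjInv hf '' s), Submodule.fg_span (hs.image _), ?_⟩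
  rw [Submodule.map_span, (Function.rightInverse_surjInv hf).image_image]

theorem finite_of_finite_quotient_smul_top {A M : Type*} [CommRing A] [AddCommGroup M] [Module A M]
    (I : Ideal A) [IsPrecomplete I A] [IsHausdorff I M]
    [Module.Finite A (M ⧸ (I • ⊤ : Submodule A M))] : Module.Finite A M := by
  obtain ⟨G, hG, hGtop⟩ := exists_fg_map_eq_of_surjective
    (Submodule.mkQ_surjective (I • ⊤ : Submodule A M)) Module.Finite.fg_top
  have : Module.Finite A G := Module.Finite.iff_fg.mpr hG
  have := isPrecomplete_of_finite I G
  refine Module.Finite.of_surjective G.subtype (surjective_of_mkQ_comp_surjective (I := I) ?_)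
  rw [← LinearMap.range_eq_top, LinearMap.range_comp, Submodule.range_subtype, hGtop]

open Polynomial in
theorem exists_isIdempotentElem_mk_eq {B : Type*} [CommRing B] {I : Ideal B} [HenselianRing B I]
    {e : B ⧸ I} (he : IsIdempotentElem e) :
    ∃ a : B, IsIdempotentElem a ∧ Ideal.Quotient.mk I a = e := by
  obtain ⟨b, rfl⟩ := Ideal.Quotient.mk_surjective e
  have he' : Ideal.Quotient.mk I b * Ideal.Quotient.mk I b = Ideal.Quotient.mk I b := he
  have hmonic : (X ^ 2 - X : B[X]).Monic := by
    nontriviality B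
    exact (monic_X_pow 2).sub_of_left (by rw [degree_X_pow, degree_X]; norm_num)
  have hroot : (X ^ 2 - X : B[X]).eval b ∈ I := by
    rw [← Ideal.Quotient.eq_zero_iff_mem]
    simp [sq, he']
  -- `(2 * e - 1)² = 1` for an idempotent `e`, so `e` is a simple root of `X² - X`.
  have hsimple : IsUnit (Ideal.Quotient.mk I ((X ^ 2 - X : B[X]).derivative.eval b)) := by
    have hderiv : (X ^ 2 - X : B[X]).derivative.eval b = 2 * b - 1 := by
      simp [one_add_one_eq_two]
    rw [hderiv, map_sub, map_mul, map_one, map_ofNat]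
    refine IsUnit.of_mul_eq_one (2 * Ideal.Quotient.mk I b - 1) ?_
    linear_combination 4 * he'
  obtain ⟨a, ha, hab⟩ := HenselianRing.is_henselian (X ^ 2 - X) hmonic b hroot hsimple
  refine ⟨a, ?_, Ideal.Quotient.eq.mpr hab⟩
  rw [IsRoot.def, eval_sub, eval_pow, eval_X] at ha
  exact sub_eq_zero.mp ((congrArg (· - a) (sq a).symm).trans ha)

theorem isLocalRing_of_isIdempotentElem_imp {C : Type*} [CommRing C] [IsArtinianRing C]
    [Nontrivial C] (h : ∀ e : C, IsIdempotentElem e → e = 0 ∨ e = 1) : IsLocalRing C := by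
  have hsub : Subsingleton (MaximalSpectrum C) := by
    refine ⟨fun p q => MaximalSpectrum.toPrimeSpectrum_injective ?_⟩
    obtain ⟨e, he, hpe⟩ := PrimeSpectrum.exists_idempotent_basicOpen_eq_of_isClopen
      (isClopen_discrete {p.toPrimeSpectrum})
    rcases h e he with rfl | rfl
    · rw [PrimeSpectrum.basicOpen_zero] at hpe
      exact absurd hpe (Set.singleton_ne_empty _)
    · rw [PrimeSpectrum.basicOpen_one] at hpe
      exact (hpe.ge (Set.mem_univ q.toPrimeSpectrum)).symm
  exact .of_singleton_maximalSpectrum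

theorem map_maximalIdeal_le_jacobson {A B : Type*} [CommRing A] [IsLocalRing A] [CommRing B]
    [Algebra A B] [Algebra.IsIntegral A B] :
    (maximalIdeal A).map (algebraMap A B) ≤ (⊥ : Ideal B).jacobson := by
  refine le_sInf fun Q hQ => ?_
  have := hQ.2
  rw [Ideal.map_le_iff_le_comap,
    eq_maximalIdeal (Ideal.isMaximal_comap_of_isIntegral_of_isMaximal (R := A) Q)]

theorem map_maximalIdeal_ne_top {A B : Type*} [CommRing A] [IsLocalRing A] [CommRing B]
    [Nontrivial B] [Algebra A B] [Algebra.IsIntegral A B] :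
    (maximalIdeal A).map (algebraMap A B) ≠ ⊤ := by
  intro h
  have hle := map_maximalIdeal_le_jacobson (A := A) (B := B)
  rw [h, top_le_iff, Ideal.jacobson_eq_top_iff] at hle
  exact bot_ne_top hle

theorem isLocalRing_of_finite {A B : Type*} [CommRing A] [IsLocalRing A]
    [IsNoetherianRing A] [IsAdicComplete (maximalIdeal A) A] [CommRing B] [IsDomain B]
    [Algebra A B] [Module.Finite A B] : IsLocalRing B := by
  set I := (maximalIdeal A).map (algebraMap A B)
  have hjac : I ≤ (⊥ : Ideal B).jacobson := map_maximalIdeal_le_jacobson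
  have : IsNoetherianRing B := IsNoetherianRing.of_finite A B
  have : IsHausdorff I B := IsHausdorff.of_le_jacobson I B hjac
  have : IsPrecomplete I B :=
    IsPrecomplete.map_algebraMap_iff.mpr (isPrecomplete_of_finite (maximalIdeal A) B)
  have : IsAdicComplete I B := { }
  have : IsArtinianRing (B ⧸ I) := by
    have : Module.Finite (A ⧸ maximalIdeal A) (B ⧸ I) :=
      Module.Finite.of_restrictScalars_finite A _ _
    let := Ideal.Quotient.field (maximalIdeal A)
    exact IsArtinianRing.of_finite (A ⧸ maximalIdeal A) (B ⧸ I)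
  have : Nontrivial (B ⧸ I) := Ideal.Quotient.nontrivial_iff.mpr map_maximalIdeal_ne_top
  have : IsLocalRing (B ⧸ I) := isLocalRing_of_isIdempotentElem_imp fun e he => by
    obtain ⟨a, ha, rfl⟩ := exists_isIdempotentElem_mk_eq he
    exact (IsIdempotentElem.iff_eq_zero_or_one.mp ha).imp
      (fun h => by rw [h, map_zero]) (fun h => by rw [h, map_one])
  have := isLocalHom_of_le_jacobson_bot I hjac
  exact RingHom.domain_isLocalRing (Ideal.Quotient.mk I)

end Completeness

/-! ### The Krull–Akizuki theorem -/

section KrullAkizuki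

theorem length_quotient_range_comp {A L M N : Type*} [Ring A] [AddCommGroup L] [Module A L]
    [AddCommGroup M] [Module A M] [AddCommGroup N] [Module A N] (f : N →ₗ[A] M) {g : M →ₗ[A] L}
    (hg : Function.Injective g) :
    Module.length A (L ⧸ LinearMap.range (g ∘ₗ f)) =
      Module.length A (M ⧸ LinearMap.range f) + Module.length A (L ⧸ LinearMap.range g) := by
  have hcomap : LinearMap.range f = (LinearMap.range (g ∘ₗ f)).comap g := by
    rw [LinearMap.range_comp, Submodule.comap_map_eq_of_injective hg]
  have hle : LinearMap.range (g ∘ₗ f) ≤ LinearMap.range g := LinearMap.range_comp_le_range f g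
  refine Module.length_eq_add_of_exact (Submodule.mapQ _ _ g hcomap.le) (Submodule.factor hle)
    ?_ (Submodule.factor_surjective hle) ?_
  · rw [← LinearMap.ker_eq_bot, Submodule.ker_mapQ, ← hcomap, Submodule.mkQ_map_self]
  · rw [LinearMap.exact_iff, Submodule.range_mapQ, Submodule.factor, Submodule.ker_mapQ,
      Submodule.comap_id]

theorem length_quotient_range_lsmul_eq {A : Type*} [CommRing A] [IsDomain A] [IsNoetherianRing A]
    [Ring.KrullDimLE 1 A] {N : Type*} [AddCommGroup N] [Module A N] [Nontrivial N] {g : N →ₗ[A] A}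
    (hg : Function.Injective g) {x : A} (hx : x ≠ 0) :
    Module.length A (N ⧸ LinearMap.range (LinearMap.lsmul A N x)) =
      Module.length A (A ⧸ LinearMap.range (LinearMap.lsmul A A x)) := by
  obtain ⟨n, hn⟩ := exists_ne (0 : N)
  have hfin : Module.length A (A ⧸ LinearMap.range g) ≠ ⊤ := by
    have hle : Ideal.span {g n} ≤ LinearMap.range g := by
      rw [Ideal.span_singleton_le_iff_mem]
      exact LinearMap.mem_range_self g n
    have hgn : g n ∈ A⁰ := mem_nonZeroDivisors_of_ne_zero ((map_ne_zero_iff g hg).mpr hn)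
    exact Module.length_ne_top_iff.mpr ((isFiniteLength_quotient_span_singleton A hgn).of_surjective
      (Submodule.factor_surjective hle))
  have hcomm : g ∘ₗ LinearMap.lsmul A N x = LinearMap.lsmul A A x ∘ₗ g :=
    LinearMap.ext fun _ => map_smul g x _
  have hlength := length_quotient_range_comp (LinearMap.lsmul A N x) hg
  rw [hcomm, length_quotient_range_comp g (LinearMap.lsmul_injective hx), add_comm] at hlength
  exact (ENat.add_left_injective_of_ne_top hfin hlength).symm

theorem finite_of_length_fg_le {A Q : Type*} [Ring A] [AddCommGroup Q] [Module A Q] (ℓ : ℕ)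
    (h : ∀ F : Submodule A Q, F.FG → Module.length A F ≤ ℓ) : Module.Finite A Q := by
  have hfin : ((fun F : Submodule A Q => Module.length A F) '' {F | F.FG}).Finite := by
    refine ((Set.finite_Iic ℓ).image ((↑) : ℕ → ℕ∞)).subset ?_
    rintro _ ⟨F, hF, rfl⟩
    obtain ⟨m, hFm, hm⟩ := ENat.le_natCast_iff.mp (h F hF)
    exact ⟨m, hm, hFm.symm⟩
  obtain ⟨F, hF, hmax⟩ := hfin.exists_maximalFor' _ _ ⟨⊥, Submodule.fg_bot⟩
  refine ⟨(Submodule.eq_top_iff'.mpr fun q => ?_ : F = ⊤) ▸ hF⟩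
  by_contra hq
  have hlt : F < F ⊔ Submodule.span A {q} := by
    rwa [left_lt_sup, Submodule.span_singleton_le_iff_mem]
  have hlength : Module.length A F < Module.length A ↥(F ⊔ Submodule.span A {q}) := by
    rw [Module.length_submodule, Module.length_submodule]
    refine Order.height_strictMono hlt ?_
    rw [← Module.length_submodule]
    exact (h F hF).trans_lt (ENat.natCast_lt_top ℓ)
  exact hlength.not_ge (hmax (hF.sup (Submodule.fg_span_singleton q)) hlength.le)

theorem exists_smul_mem_range_of_finite {A : Type*} [CommRing A]
    {K : Type*} [CommRing K] [Algebra A K] [IsFractionRing A K] {N : Type*} [AddCommGroup N]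
    [Module A N] [Module.Finite A N] (j : N →ₗ[A] K) :
    ∃ b ∈ A⁰, ∀ v, b • j v ∈ LinearMap.range (Algebra.linearMap A K) := by
  obtain ⟨s, hs⟩ := Module.Finite.fg_top (R := A) (M := N)
  obtain ⟨b, hb⟩ := IsLocalization.exist_integer_multiples A⁰ s j
  refine ⟨b, b.2, fun v => ?_⟩
  have hle : (⊤ : Submodule A N) ≤ (LinearMap.range (Algebra.linearMap A K)).comap ((b : A) • j) :=
    hs ▸ Submodule.span_le.mpr hb
  exact hle (Submodule.mem_top (x := v))

theorem exists_injective_linearMap_of_finite {A : Type*} [CommRing A] [IsDomain A]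
    {K : Type*} [Field K] [Algebra A K] [IsFractionRing A K] {N : Type*} [AddCommGroup N]
    [Module A N] [Module.Finite A N] {j : N →ₗ[A] K} (hj : Function.Injective j) :
    ∃ g : N →ₗ[A] A, Function.Injective g := by
  obtain ⟨b, hb, hint⟩ := exists_smul_mem_range_of_finite j
  let e := LinearEquiv.ofInjective (Algebra.linearMap A K) (IsFractionRing.injective A K)
  refine ⟨e.symm.toLinearMap ∘ₗ (b • j).codRestrict _ hint,
    e.symm.injective.comp fun v w h => hj ?_⟩
  have : Module.IsTorsionFree A K := inferInstance
  exact smul_right_injective K (nonZeroDivisors.ne_zero hb) (congrArg Subtype.val h)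

theorem finite_quotient_range_lsmul {A : Type*} [CommRing A] [IsDomain A] [IsNoetherianRing A]
    [Ring.KrullDimLE 1 A] {K : Type*} [Field K] [Algebra A K] [IsFractionRing A K]
    {V : Type*} [AddCommGroup V] [Module A V] {j : V →ₗ[A] K} (hj : Function.Injective j)
    {x : A} (hx : x ≠ 0) :
    Module.Finite A (V ⧸ LinearMap.range (LinearMap.lsmul A V x)) := by
  obtain ⟨ℓ, hℓ⟩ : ∃ ℓ : ℕ, ℓ = Module.length A (A ⧸ LinearMap.range (LinearMap.lsmul A A x)) := by
    have hle : Ideal.span {x} ≤ LinearMap.range (LinearMap.lsmul A A x) := by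
      rw [Ideal.span_singleton_le_iff_mem]
      exact ⟨1, mul_one x⟩
    exact ENat.ne_top_iff_exists.mp (Module.length_ne_top_iff.mpr
      ((isFiniteLength_quotient_span_singleton A (mem_nonZeroDivisors_of_ne_zero hx)).of_surjective
        (Submodule.factor_surjective hle)))
  refine finite_of_length_fg_le ℓ fun F hF => ?_
  obtain ⟨G, hG, rfl⟩ := exists_fg_map_eq_of_surjective (Submodule.mkQ_surjective _) hF
  rcases subsingleton_or_nontrivial G with hG0 | hG0
  · rw [Submodule.subsingleton_iff_eq_bot.mp hG0, Submodule.map_bot, Module.length_bot]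
    exact zero_le
  have : Module.Finite A G := Module.Finite.iff_fg.mpr hG
  obtain ⟨g, hg⟩ := exists_injective_linearMap_of_finite (j := j ∘ₗ G.subtype)
    (hj.comp G.subtype_injective)
  have hle : LinearMap.range (LinearMap.lsmul A G x) ≤
      (LinearMap.range (LinearMap.lsmul A V x)).comap G.subtype := by
    rintro _ ⟨n, rfl⟩
    exact ⟨n, rfl⟩
  have hrange : LinearMap.range (Submodule.mapQ _ _ G.subtype hle) = G.map (Submodule.mkQ _) := by
    rw [Submodule.range_mapQ, Submodule.range_subtype]
  rw [hℓ, ← length_quotient_range_lsmul_eq hg hx, ← hrange]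
  exact Module.length_le_of_surjective _ (LinearMap.surjective_rangeRestrict _)

end KrullAkizuki

/-! ### Normalization of the branches -/

section Normalization

variable (A K : Type*) [CommRing A] [IsDomain A] [IsNoetherianRing A] [Ring.KrullDimLE 1 A]
  [IsLocalRing A] [Field K] [Algebra A K] [IsFractionRing A K]

theorem isHausdorff_integralClosure (hA : ¬ IsField A) :
    IsHausdorff (maximalIdeal A) (integralClosure A K) := by
  set V := integralClosure A K
  refine ⟨fun v hv => by_contra fun hv0 => ?_⟩
  obtain ⟨x, hxm, hx⟩ := Submodule.exists_mem_ne_zero_of_ne_bot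
    (isField_iff_maximalIdeal_eq.not.mp hA)
  obtain ⟨a, ha, ha0⟩ := Submodule.exists_mem_ne_zero_of_ne_bot
    (Ideal.comap_ne_bot_of_integral_mem (R := A) hv0 (Ideal.mem_span_singleton_self v)
      (Algebra.IsIntegral.isIntegral v))
  obtain ⟨w, hw⟩ := Ideal.mem_span_singleton'.mp ha
  have hfin := finite_quotient_range_lsmul (j := V.val.toLinearMap) Subtype.val_injective
    (mul_ne_zero ha0 hx)
  set N := LinearMap.range (LinearMap.lsmul A V (a * x))
  have hvN : N.mkQ v = 0 := by
    have hhaus : IsHausdorff (maximalIdeal A) (V ⧸ N) := inferInstance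
    refine hhaus.haus _ fun n => ?_
    have hmap := Submodule.mem_map_of_mem (f := N.mkQ) (SModEq.zero.mp (hv n))
    rw [Submodule.map_smul''] at hmap
    exact SModEq.zero.mpr (Submodule.smul_mono le_rfl le_top hmap)
  obtain ⟨u, hu⟩ := (Submodule.Quotient.mk_eq_zero _).mp hvN
  refine map_maximalIdeal_ne_top (A := A) (B := V) ((Ideal.eq_top_iff_one _).mpr ?_)
  have hone : 1 = w * u * algebraMap A V x := by
    refine mul_left_cancel₀ hv0 ?_
    calc v * 1 = algebraMap A V (a * x) * u := by
          rw [mul_one, ← Algebra.smul_def]; exact hu.symm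
      _ = v * (w * u * algebraMap A V x) := by rw [map_mul, ← hw]; ring
  rw [hone]
  exact Ideal.mul_mem_left _ _ (Ideal.mem_map_of_mem _ hxm)

variable [IsAdicComplete (maximalIdeal A) A]

theorem finite_integralClosure (hA : ¬ IsField A) : Module.Finite A (integralClosure A K) := by
  set V := integralClosure A K
  obtain ⟨x, hxm, hx⟩ := Submodule.exists_mem_ne_zero_of_ne_bot
    (isField_iff_maximalIdeal_eq.not.mp hA)
  have hfin := finite_quotient_range_lsmul (j := V.val.toLinearMap) Subtype.val_injective hx
  have hle : LinearMap.range (LinearMap.lsmul A V x) ≤ maximalIdeal A • ⊤ := by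
    rintro _ ⟨v, rfl⟩
    exact Submodule.smul_mem_smul hxm Submodule.mem_top
  have : Module.Finite A (V ⧸ (maximalIdeal A • ⊤ : Submodule A V)) :=
    Module.Finite.of_surjective _ (Submodule.factor_surjective hle)
  have := isHausdorff_integralClosure A K hA
  exact finite_of_finite_quotient_smul_top (maximalIdeal A)

theorem isDiscreteValuationRing_integralClosure (hA : ¬ IsField A) :
    IsDiscreteValuationRing (integralClosure A K) := by
  have := finite_integralClosure A K hA
  have : IsNoetherianRing (integralClosure A K) := IsNoetherianRing.of_finite A _
  have : IsLocalRing (integralClosure A K) := isLocalRing_of_finite (A := A)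
  have : IsIntegrallyClosed (integralClosure A K) :=
    integralClosure.isIntegrallyClosedOfFiniteExtension K
  have : Ring.DimensionLEOne A :=
    ⟨fun hp hprime => hprime.isMaximal_of_ne_bot hp⟩
  have : IsDedekindDomain (integralClosure A K) := { }
  have hV : ¬ IsField (integralClosure A K) := fun h =>
    hA (isField_of_isIntegral_of_isField (FaithfulSMul.algebraMap_injective _ _) h)
  exact ((IsDiscreteValuationRing.TFAE (integralClosure A K) hV).out 0 2).mpr this

end Normalization

section NormVal

variable {A : Type u} [CommRing A] [IsDomain A]

theorem normVal_lt_one_iff [h : IsDiscreteValuationRing (integralClosure A (FractionRing A))]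
    (v : integralClosure A (FractionRing A)) :
    normVal A v < 1 ↔ v ∈ maximalIdeal (integralClosure A (FractionRing A)) := by
  have : IsFractionRing (integralClosure A (FractionRing A)) (FractionRing A) :=
    integralClosure.isFractionRing_of_finite_extension (FractionRing A) (FractionRing A)
  rw [normVal, dif_pos h]
  exact IsDedekindDomain.HeightOneSpectrum.valuation_lt_one_iff_mem _ v

theorem normVal_le_one_iff [h : IsDiscreteValuationRing (integralClosure A (FractionRing A))]
    (x : FractionRing A) : normVal A x ≤ 1 ↔ x ∈ integralClosure A (FractionRing A) := by
  have : IsFractionRing (integralClosure A (FractionRing A)) (FractionRing A) :=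
    integralClosure.isFractionRing_of_finite_extension (FractionRing A) (FractionRing A)
  rw [normVal, dif_pos h]
  refine ⟨fun hx => ?_, fun hx =>
    IsDedekindDomain.HeightOneSpectrum.valuation_le_one _ (⟨x, hx⟩ : integralClosure A _)⟩
  obtain ⟨v, rfl⟩ := IsDiscreteValuationRing.exists_lift_of_le_one hx
  exact v.2

theorem exists_normVal_eq_exp [h : IsDiscreteValuationRing (integralClosure A (FractionRing A))]
    (n : ℤ) : ∃ x, normVal A x = WithZero.exp n := by
  have : IsFractionRing (integralClosure A (FractionRing A)) (FractionRing A) :=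
    integralClosure.isFractionRing_of_finite_extension (FractionRing A) (FractionRing A)
  obtain ⟨x, hx⟩ := IsDedekindDomain.HeightOneSpectrum.valuation_exists_uniformizer
    (FractionRing A) (IsDiscreteValuationRing.maximalIdeal (integralClosure A (FractionRing A)))
  refine ⟨x ^ (-n), ?_⟩
  rw [normVal, dif_pos h, map_zpow₀, hx, ← WithZero.exp_zsmul, smul_neg, neg_smul, neg_neg,
    smul_eq_mul, mul_one]

end NormVal

/-! ### The total ring of fractions and its branches -/

section TotalFractions

theorem mem_nonZeroDivisors_of_forall_map_ne_zero {ι A : Type*} [CommRing A] {F : ι → Type*}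
    [∀ i, CommRing (F i)] [∀ i, NoZeroDivisors (F i)] {φ : ∀ i, A →+* F i}
    (hφ : ∀ y, (∀ i, φ i y = 0) → y = 0) {x : A} (hx : ∀ i, φ i x ≠ 0) : x ∈ A⁰ := by
  refine mem_nonZeroDivisors_iff_right.mpr fun y hy => hφ y fun i => ?_
  have hyx : φ i y * φ i x = 0 := by rw [← map_mul, hy, map_zero]
  exact (mul_eq_zero.mp hyx).resolve_right (hx i)

theorem eq_zero_of_forall_map_eq_zero {ι : Type*} (A : Type*) {K : Type*} [CommRing A] [CommRing K]
    [Algebra A K] [IsFractionRing A K] {F : ι → Type*} [∀ i, CommRing (F i)] {φ : ∀ i, K →+* F i}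
    (hφ : ∀ a : A, (∀ i, φ i (algebraMap A K a) = 0) → a = 0) {x : K} (hx : ∀ i, φ i x = 0) :
    x = 0 := by
  obtain ⟨a, s, rfl⟩ := IsLocalization.exists_mk'_eq A⁰ x
  rw [hφ a fun i => ?_, IsLocalization.mk'_zero]
  rw [← IsLocalization.mk'_spec K a s, map_mul, hx, zero_mul]

theorem mem_nonZeroDivisors_iff_forall_map_ne_zero {ι : Type*} (A : Type*) {K : Type*} [CommRing A]
    [CommRing K] [Algebra A K] [IsFractionRing A K] {F : ι → Type*} [∀ i, Field (F i)]
    {φ : ∀ i, K →+* F i} (hφ : ∀ y, (∀ i, φ i y = 0) → y = 0) {x : K} :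
    x ∈ K⁰ ↔ ∀ i, φ i x ≠ 0 := by
  refine ⟨fun hx i => ?_, mem_nonZeroDivisors_of_forall_map_ne_zero hφ⟩
  have hunit : IsUnit x := (IsFractionRing.nonZeroDivisors_eq_isUnit A K).le hx
  exact (hunit.map (φ i)).ne_zero

variable {R : Type u} [CommRing R] {r : ℕ} (P : Fin r ≃ minimalPrimes R)

theorem exists_notMem_and_forall_mem (i : Fin r) :
    ∃ s : R, s ∉ (P i).1 ∧ ∀ j, j ≠ i → s ∈ (P j).1 := by
  have hsep : ∀ j, ∃ t : R, t ∉ (P i).1 ∧ (j ≠ i → t ∈ (P j).1) := by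
    intro j
    by_cases hj : j = i
    · exact ⟨1, (Ideal.ne_top_iff_one _).mp (P i).2.1.1.ne_top, fun h => absurd hj h⟩
    · have hnle : ¬ (P j).1 ≤ (P i).1 := fun hle =>
        hj (P.injective (Subtype.ext (le_antisymm hle ((P i).2.2 (P j).2.1 hle))))
      obtain ⟨t, htj, hti⟩ := Set.not_subset.mp hnle
      exact ⟨t, hti, fun _ => htj⟩
  choose t hti htj using hsep
  refine ⟨∏ j, t j, fun hm => ?_, fun j hj => ?_⟩
  · obtain ⟨j, -, hj⟩ := (P i).2.1.1.prod_mem_iff.mp hm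
    exact hti j hj
  · exact Ideal.mem_of_dvd _ (Finset.dvd_prod_of_mem t (Finset.mem_univ j)) (htj j hj)

theorem projBranch_algebraMap (i : Fin r) (a : R) :
    projBranch P i (algebraMap R (FractionRing R) a) =
      algebraMap (BranchRing P i) (BranchField P i) (Ideal.Quotient.mk _ a) :=
  IsLocalization.map_eq _ _

theorem projBranch_algebraMap_eq_zero_iff (i : Fin r) (a : R) :
    projBranch P i (algebraMap R (FractionRing R) a) = 0 ↔ a ∈ (P i).1 := by
  rw [projBranch_algebraMap, IsFractionRing.to_map_eq_zero_iff, Ideal.Quotient.eq_zero_iff_mem]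

theorem val_eq_zero_iff (i : Fin r) (x : FractionRing R) :
    val P i x = 0 ↔ projBranch P i x = 0 :=
  Valuation.zero_iff _

theorem projPartial_algebraMap (J : Finset (Fin r)) (a : R) :
    projPartial P J (algebraMap R (FractionRing R) a) =
      algebraMap (PartialRing P J) (PartialFrac P J) (Ideal.Quotient.mk _ a) :=
  IsLocalization.map_eq (regular_le_comap_partial P J) a

theorem projPartialBranch_algebraMap_mk (J : Finset (Fin r)) (j : J) (a : R) :
    projPartialBranch P J j (algebraMap (PartialRing P J) (PartialFrac P J)
      (Ideal.Quotient.mk _ a)) =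
        algebraMap (BranchRing P j) (BranchField P j) (Ideal.Quotient.mk _ a) :=
  IsLocalization.map_eq _ _

theorem projPartialBranch_projPartial (J : Finset (Fin r)) (j : J) (x : FractionRing R) :
    projPartialBranch P J j (projPartial P J x) = projBranch P j x := by
  have hcomp : (projPartialBranch P J j).comp (projPartialHom P J) = projBranch P j := by
    refine IsLocalization.ringHom_ext R⁰ (RingHom.ext fun a => ?_)
    calc projPartialBranch P J j (projPartial P J (algebraMap R _ a))
        = algebraMap (BranchRing P j) (BranchField P j) (Ideal.Quotient.mk _ a) := by
          rw [projPartial_algebraMap, projPartialBranch_algebraMap_mk]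
      _ = projBranch P j (algebraMap R _ a) := (projBranch_algebraMap P j a).symm
  exact RingHom.congr_fun hcomp x

theorem partialVal_projPartial (J : Finset (Fin r)) (j : J) (x : FractionRing R) :
    partialVal P J j (projPartial P J x) = val P j x :=
  congrArg (normVal _) (projPartialBranch_projPartial P J j x)

theorem eq_zero_of_projPartialBranch_eq_zero (J : Finset (Fin r)) {x : PartialFrac P J}
    (hx : ∀ j, projPartialBranch P J j x = 0) : x = 0 := by
  refine eq_zero_of_forall_map_eq_zero (PartialRing P J) (fun a ha => ?_) hx
  obtain ⟨a, rfl⟩ := Ideal.Quotient.mk_surjective a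
  simp only [projPartialBranch_algebraMap_mk, IsFractionRing.to_map_eq_zero_iff,
    Ideal.Quotient.eq_zero_iff_mem] at ha ⊢
  simp only [Submodule.mem_iInf]
  exact fun j hj => ha ⟨j, hj⟩

theorem projPartial_mem_nonZeroDivisors_iff (J : Finset (Fin r)) (x : FractionRing R) :
    projPartial P J x ∈ (PartialFrac P J)⁰ ↔ ∀ j ∈ J, val P j x ≠ 0 := by
  rw [mem_nonZeroDivisors_iff_forall_map_ne_zero (PartialRing P J)
    fun _ => eq_zero_of_projPartialBranch_eq_zero P J]
  simp only [projPartialBranch_projPartial, Subtype.forall, ne_eq, val_eq_zero_iff]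

variable [IsReduced R]

theorem eq_zero_of_forall_mem {x : R} (hx : ∀ i, x ∈ (P i).1) : x = 0 := by
  have hmem : x ∈ sInf (minimalPrimes R) :=
    Submodule.mem_sInf.mpr fun p hp => by
      simpa only [P.apply_symm_apply] using hx (P.symm ⟨p, hp⟩)
  rwa [minimalPrimes, Ideal.sInf_minimalPrimes, Ideal.radical_bot_of_isReduced] at hmem

theorem mem_nonZeroDivisors_of_forall_notMem {x : R} (hx : ∀ i, x ∉ (P i).1) : x ∈ R⁰ :=
  mem_nonZeroDivisors_of_forall_map_ne_zero (φ := fun i => Ideal.Quotient.mk (P i).1)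
    (fun _ hy => eq_zero_of_forall_mem P fun i => Ideal.Quotient.eq_zero_iff_mem.mp (hy i))
    fun i => Ideal.Quotient.eq_zero_iff_mem.not.mpr (hx i)

theorem eq_zero_of_projBranch_eq_zero {x : FractionRing R} (hx : ∀ i, projBranch P i x = 0) :
    x = 0 :=
  eq_zero_of_forall_map_eq_zero R (fun a ha => eq_zero_of_forall_mem P fun i =>
    (projBranch_algebraMap_eq_zero_iff P i a).mp (ha i)) hx

theorem mem_nonZeroDivisors_fractionRing_iff (x : FractionRing R) :
    x ∈ (FractionRing R)⁰ ↔ ∀ i, val P i x ≠ 0 := by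
  rw [mem_nonZeroDivisors_iff_forall_map_ne_zero R fun _ => eq_zero_of_projBranch_eq_zero P]
  simp only [ne_eq, val_eq_zero_iff]

theorem exists_mem_nonZeroDivisors_sub_mul_mem (i : Fin r) {c : R} (hc : c ∉ (P i).1) :
    ∃ d ∈ R⁰, ∃ s, (∀ j, j ≠ i → s ∈ (P j).1) ∧ d - c * s ∈ (P i).1 := by
  choose s hs hs' using exists_notMem_and_forall_mem P
  set t : Fin r → R := Function.update s i (c * s i)
  have hti : t i = c * s i := Function.update_self ..
  have htj : ∀ j, j ≠ i → t j = s j := fun j hj => Function.update_of_ne hj ..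
  have ht : ∀ j, t j ∉ (P j).1 := by
    intro j
    obtain rfl | hj := eq_or_ne j i
    · exact hti ▸ (P j).2.1.1.mul_notMem hc (hs j)
    · exact htj j hj ▸ hs j
  have ht' : ∀ j k, k ≠ j → t k ∈ (P j).1 := by
    intro j k hk
    obtain rfl | hki := eq_or_ne k i
    · exact hti ▸ Ideal.mul_mem_left _ _ (hs' k j hk.symm)
    · exact htj k hki ▸ hs' k j hk.symm
  have hsum : ∀ j, ∑ k, t k - t j ∈ (P j).1 := by
    intro j
    rw [← Finset.add_sum_erase _ _ (Finset.mem_univ j), add_sub_cancel_left]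
    exact Ideal.sum_mem _ fun k hk => ht' j k (Finset.ne_of_mem_erase hk)
  refine ⟨∑ k, t k, mem_nonZeroDivisors_of_forall_notMem P fun j hj => ht j ?_, s i, hs' i,
    hti ▸ hsum i⟩
  exact (Submodule.sub_mem_iff_right _ hj).mp (hsum j)

theorem exists_projBranch_eq_and_eq_zero (i : Fin r) (z : BranchField P i) :
    ∃ x, projBranch P i x = z ∧ ∀ j, j ≠ i → projBranch P j x = 0 := by
  obtain ⟨a, b, rfl⟩ := IsLocalization.exists_mk'_eq (BranchRing P i)⁰ z
  obtain ⟨a, rfl⟩ := Ideal.Quotient.mk_surjective a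
  obtain ⟨c, hcb⟩ := Ideal.Quotient.mk_surjective b.1
  have hc : c ∉ (P i).1 := by
    rw [← Ideal.Quotient.eq_zero_iff_mem, hcb]
    exact nonZeroDivisors.ne_zero b.2
  obtain ⟨d, hd, s, hs, hdc⟩ := exists_mem_nonZeroDivisors_sub_mul_mem P i hc
  set x := IsLocalization.mk' (FractionRing R) (a * s) (⟨d, hd⟩ : R⁰)
  have hx : ∀ j, projBranch P j x * projBranch P j (algebraMap R _ d) =
      projBranch P j (algebraMap R _ (a * s)) := by
    intro j
    rw [← map_mul]
    exact congrArg _ (IsLocalization.mk'_spec _ _ _)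
  have hne : ∀ j, projBranch P j (algebraMap R _ d) ≠ 0 := fun j =>
    (projBranch_algebraMap_eq_zero_iff P j d).not.mpr (regular_notMem P j hd)
  refine ⟨x, mul_right_cancel₀ (hne i) ((hx i).trans ?_), fun j hj => ?_⟩
  · simp only [projBranch_algebraMap, Ideal.Quotient.eq.mpr hdc, map_mul, hcb]
    rw [← mul_assoc, IsLocalization.mk'_spec]
  · refine (mul_eq_zero.mp ((hx j).trans ?_)).resolve_right (hne j)
    exact (projBranch_algebraMap_eq_zero_iff P j _).mpr (Ideal.mul_mem_left _ _ (hs j hj))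

end TotalFractions

/-- A valuation on an algebra over a local ring `R` that is nonnegative on `R`, positive on the
maximal ideal, and whose residue field is that of `R`. -/
structure IsResiduallyRational (R : Type*) {K : Type*} [CommRing R] [IsLocalRing R] [CommRing K]
    [Algebra R K] (v : Valuation K ℤᵐ⁰) : Prop where
  le_one : ∀ a : R, v (algebraMap R K a) ≤ 1
  lt_one : ∀ a ∈ maximalIdeal R, v (algebraMap R K a) < 1
  exists_sub_smul_lt : ∀ {x y : K}, v x ≤ v y → v y ≠ 0 → ∃ a : R, v (x - a • y) < v y

/-- A family of residually rational discrete valuations on `K` that behave like the valuations of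
the factors of a product decomposition of `K`, with at most as many members as the residue field of
`R` has elements. -/
structure IsBranchSystem (R : Type*) {K : Type*} [CommRing R] [IsLocalRing R] [CommRing K]
    [Algebra R K] {ι : Type*} (w : ι → Valuation K ℤᵐ⁰) : Prop where
  isResiduallyRational : ∀ i, IsResiduallyRational R (w i)
  exists_proj : ∀ i, ∃ e : K, w i (1 - e) = 0 ∧ ∀ j, j ≠ i → w j e = 0
  exists_eq_exp : ∀ i (n : ℤ), ∃ x, w i x = WithZero.exp n
  card_le : ENat.card ι ≤ ENat.card (ResidueField R)

section Admissible

variable {R : Type u} [CommRing R] {r : ℕ} (P : Fin r ≃ minimalPrimes R)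

/-- The map induced by `π_i` between the integral closures of `R` in `K` and of `R_i` in `K_i`. -/
noncomputable def normalizationMap (i : Fin r) : integralClosure R (FractionRing R) →ₐ[R]
    integralClosure (BranchRing P i) (BranchField P i) where
  toRingHom := RingHom.codRestrict ((projBranch P i).comp
    (integralClosure R (FractionRing R)).val.toRingHom) _ fun x =>
      IsIntegral.map_of_comp_eq (Ideal.Quotient.mk (P i).1) (projBranch P i)
        (RingHom.ext fun a => (projBranch_algebraMap P i a).symm) x.2
  commutes' a := Subtype.ext (projBranch_algebraMap P i a)

theorem exists_isIntegral_projBranch_eq_and_eq_zero [IsReduced R] (i : Fin r) {v : BranchField P i}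
    (hv : IsIntegral (BranchRing P i) v) :
    ∃ x, IsIntegral R x ∧ projBranch P i x = v ∧ ∀ j, j ≠ i → projBranch P j x = 0 := by
  obtain ⟨x, hxi, hxj⟩ := exists_projBranch_eq_and_eq_zero P i v
  obtain ⟨p, hp, hpv⟩ := isIntegral_trans (R := R) v hv
  refine ⟨x, ⟨Polynomial.X * p, Polynomial.monic_X.mul hp, ?_⟩, hxi, hxj⟩
  refine eq_zero_of_projBranch_eq_zero P fun j => ?_
  rw [Polynomial.eval₂_mul, Polynomial.eval₂_X, map_mul]
  obtain rfl | hj := eq_or_ne j i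
  · have hcomp : (projBranch P j).comp (algebraMap R (FractionRing R)) =
        algebraMap R (BranchField P j) := RingHom.ext (projBranch_algebraMap P j)
    rw [Polynomial.hom_eval₂, hxi, hcomp, hpv, mul_zero]
  · rw [hxj j hj, zero_mul]

theorem normalizationMap_surjective [IsReduced R] (i : Fin r) :
    Function.Surjective (normalizationMap P i) := by
  rintro ⟨v, hv⟩
  obtain ⟨x, hx, hxv, -⟩ := exists_isIntegral_projBranch_eq_and_eq_zero P i hv
  exact ⟨⟨x, hx⟩, Subtype.ext hxv⟩

variable [IsLocalRing R]

theorem isLocalRing_branchRing (i : Fin r) : IsLocalRing (BranchRing P i) :=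
  .of_surjective' (Ideal.Quotient.mk _) Ideal.Quotient.mk_surjective

namespace IsCompleteAdmissible

theorem isReduced (hR : IsCompleteAdmissible R) : IsReduced R := by
  have := hR.complete
  have := hR.analyticallyReduced
  exact isReduced_of_injective (algebraMap R (AdicCompletion (maximalIdeal R) R))
    (AdicCompletion.of_injective (maximalIdeal R) R)

theorem krullDimLE_branchRing (hR : IsCompleteAdmissible R) (i : Fin r) :
    Ring.KrullDimLE 1 (BranchRing P i) :=
  Ring.krullDimLE_iff.mpr ((ringKrullDim_quotient_le _).trans_eq hR.dim_one)

theorem not_isField_branchRing (hR : IsCompleteAdmissible R) (i : Fin r) :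
    ¬ IsField (BranchRing P i) := by
  intro h
  obtain ⟨x, hxm, hx⟩ := hR.cohenMacaulay
  rw [← eq_maximalIdeal (Ideal.Quotient.maximal_of_isField _ h)] at hxm
  exact regular_notMem P i hx hxm

theorem isAdicComplete_branchRing (hR : IsCompleteAdmissible R) (i : Fin r)
    [IsLocalRing (BranchRing P i)] :
    IsAdicComplete (maximalIdeal (BranchRing P i)) (BranchRing P i) := by
  have := hR.noetherian
  have := hR.complete
  have : IsPrecomplete (maximalIdeal R) (BranchRing P i) := isPrecomplete_of_finite _ _
  rw [← map_maximalIdeal_of_surjective (algebraMap R (BranchRing P i)) Ideal.Quotient.mk_surjective,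
    IsAdicComplete.map_algebraMap_iff]
  exact { }

theorem isDiscreteValuationRing (hR : IsCompleteAdmissible R) (i : Fin r) :
    IsDiscreteValuationRing (integralClosure (BranchRing P i) (BranchField P i)) := by
  have := hR.noetherian
  have := hR.krullDimLE_branchRing P i
  have := isLocalRing_branchRing P i
  have := hR.isAdicComplete_branchRing P i
  exact isDiscreteValuationRing_integralClosure _ _ (hR.not_isField_branchRing P i)

theorem finite_integralClosure_branchRing (hR : IsCompleteAdmissible R) (i : Fin r) :
    Module.Finite (BranchRing P i) (integralClosure (BranchRing P i) (BranchField P i)) := by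
  have := hR.noetherian
  have := hR.krullDimLE_branchRing P i
  have := isLocalRing_branchRing P i
  have := hR.isAdicComplete_branchRing P i
  exact finite_integralClosure _ _ (hR.not_isField_branchRing P i)

theorem finite_integralClosure_fractionRing (P : Fin r ≃ minimalPrimes R)
    (hR : IsCompleteAdmissible R) :
    Module.Finite R (integralClosure R (FractionRing R)) := by
  have := hR.noetherian
  have := hR.isReduced
  have : ∀ i, Module.Finite R (integralClosure (BranchRing P i) (BranchField P i)) := by
    intro i
    have := hR.finite_integralClosure_branchRing P i
    exact Module.Finite.trans (BranchRing P i) _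
  refine Module.Finite.of_injective
    (LinearMap.pi fun i => (normalizationMap P i).toLinearMap) ?_
  refine (injective_iff_map_eq_zero _).mpr fun x hx => Subtype.ext ?_
  exact eq_zero_of_projBranch_eq_zero P fun i => congrArg Subtype.val (congrFun hx i)

theorem val_lt_one (hR : IsCompleteAdmissible R) (i : Fin r) {a : R} (ha : a ∈ maximalIdeal R) :
    val P i (algebraMap R (FractionRing R) a) < 1 := by
  have := hR.isDiscreteValuationRing P i
  set V := integralClosure (BranchRing P i) (BranchField P i)
  have : Algebra.IsIntegral R V := Algebra.IsIntegral.trans (BranchRing P i)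
  rw [val, Valuation.comap_apply, projBranch_algebraMap]
  exact (normVal_lt_one_iff (algebraMap R V a)).mpr
    (le_maximalIdeal map_maximalIdeal_ne_top (Ideal.mem_map_of_mem _ ha))

theorem val_le_one_iff (hR : IsCompleteAdmissible R) (i : Fin r) (x : FractionRing R) :
    val P i x ≤ 1 ↔ IsIntegral (BranchRing P i) (projBranch P i x) := by
  have := hR.isDiscreteValuationRing P i
  exact normVal_le_one_iff _

theorem exists_normVal_sub_lt_one (hR : IsCompleteAdmissible R) (i : Fin r) {v : BranchField P i}
    (hv : IsIntegral (BranchRing P i) v) :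
    ∃ a : R, normVal (BranchRing P i) (v - algebraMap R (BranchField P i) a) < 1 := by
  have := hR.isReduced
  have := hR.isDiscreteValuationRing P i
  set V := integralClosure (BranchRing P i) (BranchField P i)
  have hmax : ((maximalIdeal V).comap (normalizationMap P i)).IsMaximal :=
    Ideal.comap_isMaximal_of_surjective _ (normalizationMap_surjective P i)
  obtain ⟨x, hx⟩ := normalizationMap_surjective P i ⟨v, hv⟩
  obtain ⟨a, ha⟩ := hR.residuallyRational _ hmax (Ideal.Quotient.mk _ x)
  have hmem : x - algebraMap R _ a ∈ (maximalIdeal V).comap (normalizationMap P i) :=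
    Ideal.Quotient.eq.mp ha.symm
  rw [Ideal.mem_comap, map_sub, hx, AlgHom.commutes] at hmem
  exact ⟨a, (normVal_lt_one_iff _).mpr hmem⟩

theorem exists_val_sub_smul_lt (hR : IsCompleteAdmissible R) (i : Fin r) {x y : FractionRing R}
    (hxy : val P i x ≤ val P i y) (hy : val P i y ≠ 0) :
    ∃ a : R, val P i (x - a • y) < val P i y := by
  have := hR.isDiscreteValuationRing P i
  have hy0 : projBranch P i y ≠ 0 := (val_eq_zero_iff P i y).not.mp hy
  have hquot : IsIntegral (BranchRing P i) (projBranch P i x / projBranch P i y) := by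
    refine (normVal_le_one_iff _).mp ?_
    rw [map_div₀]
    exact div_le_one_of_le₀ hxy zero_le
  obtain ⟨a, ha⟩ := hR.exists_normVal_sub_lt_one P i hquot
  refine ⟨a, ?_⟩
  have hfactor : projBranch P i (x - a • y) = (projBranch P i x / projBranch P i y -
      algebraMap R (BranchField P i) a) * projBranch P i y := by
    rw [Algebra.smul_def, map_sub, map_mul, projBranch_algebraMap, sub_mul,
      div_mul_cancel₀ _ hy0]
    rfl
  rw [val, Valuation.comap_apply, hfactor, map_mul]
  exact mul_lt_of_lt_one_left (zero_lt_iff.mpr hy) ha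

theorem isBranchSystem (hR : IsCompleteAdmissible R) : IsBranchSystem R (val P) where
  isResiduallyRational i :=
    { le_one := val_algebraMap_le_one P i
      lt_one _ := hR.val_lt_one P i
      exists_sub_smul_lt := hR.exists_val_sub_smul_lt P i }
  exists_proj i := by
    have := hR.isReduced
    obtain ⟨e, hei, hej⟩ := exists_projBranch_eq_and_eq_zero P i 1
    refine ⟨e, ?_, fun j hj => (val_eq_zero_iff P j e).mpr (hej j hj)⟩
    rw [val_eq_zero_iff, map_sub, map_one, hei, sub_self]
  exists_eq_exp i n := by
    have := hR.isReduced
    have := hR.isDiscreteValuationRing P i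
    obtain ⟨y, hy⟩ := exists_normVal_eq_exp (A := BranchRing P i) n
    obtain ⟨x, rfl, -⟩ := exists_projBranch_eq_and_eq_zero P i y
    exact ⟨x, hy⟩
  card_le := (ENat.card_congr P).trans_le hR.largeResidueField

theorem isIntegral_of_forall_val_le_one (hR : IsCompleteAdmissible R) {x : FractionRing R}
    (hx : ∀ i, val P i x ≤ 1) : IsIntegral R x := by
  have := hR.isReduced
  choose y hy hyi hyj using fun i => exists_isIntegral_projBranch_eq_and_eq_zero P i
    ((hR.val_le_one_iff P i x).mp (hx i))
  have hsum : x = ∑ i, y i := by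
    refine sub_eq_zero.mp (eq_zero_of_projBranch_eq_zero P fun i => ?_)
    rw [map_sub, map_sum, Fintype.sum_eq_single i fun j hj => hyj j i hj.symm, hyi, sub_self]
  exact hsum ▸ IsIntegral.sum _ fun i _ => hy i

theorem exists_smul_mem_range_of_forall_val_le_one (hR : IsCompleteAdmissible R) :
    ∃ d ∈ R⁰, ∀ x : FractionRing R, (∀ i, val P i x ≤ 1) →
      d • x ∈ LinearMap.range (Algebra.linearMap R (FractionRing R)) := by
  have := hR.finite_integralClosure_fractionRing P
  obtain ⟨d, hd, hint⟩ := exists_smul_mem_range_of_finite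
    (integralClosure R (FractionRing R)).val.toLinearMap
  exact ⟨d, hd, fun x hx => hint ⟨x, hR.isIntegral_of_forall_val_le_one P hx⟩⟩

end IsCompleteAdmissible

end Admissible

/-! ### Counting and lengths -/

section Order

theorem exists_isLeast_of_infClosed {α : Type*} [SemilatticeInf α] [LocallyFiniteOrder α]
    {E : Set α} (hne : E.Nonempty) (hinf : InfClosed E) (hbdd : BddBelow E) :
    ∃ a, IsLeast E a := by
  obtain ⟨b, hb⟩ := hbdd
  obtain ⟨a, ha⟩ := hne
  obtain ⟨m, ⟨hmE, hma⟩, hmin⟩ := Set.Finite.exists_minimal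
    (s := E ∩ Set.Iic a) ((Set.finite_Icc b a).subset fun x hx => ⟨hb hx.1, hx.2⟩) ⟨a, ha, le_rfl⟩
  refine ⟨m, hmE, fun x hx => ?_⟩
  exact (hmin ⟨hinf hmE hx, inf_le_left.trans hma⟩ inf_le_left).trans inf_le_right

variable {S X : Set ℤ} {a g : ℤ}

theorem gaps_eq_Ico_diff (ha : IsLeast S a) (hS : Set.Ici g ⊆ S) : gaps S = Set.Ico a g \ S := by
  ext x
  refine ⟨fun ⟨⟨y, hy, hyx⟩, hx⟩ => ⟨⟨(ha.2 hy).trans hyx.le, ?_⟩, hx⟩,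
    fun ⟨hax, hx⟩ => ⟨⟨a, ha.1, hax.1.lt_of_ne fun h => hx (h ▸ ha.1)⟩, hx⟩⟩
  exact not_le.mp fun hgx => hx (hS hgx)

theorem diff_eq_Ico_inter_diff (ha : IsLeast S a) (hX : Set.Ici g ⊆ X) :
    S \ X = (Set.Ico a g ∩ S) \ X := by
  ext x
  refine ⟨fun ⟨hx, hxX⟩ => ⟨⟨⟨ha.2 hx, ?_⟩, hx⟩, hxX⟩, fun ⟨hx, hxX⟩ => ⟨hx.2, hxX⟩⟩
  exact not_le.mp fun hgx => hxX (hX hgx)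

theorem inter_Iio_eq_Ico_inter_inter (ha : IsLeast S a) (hXS : X ⊆ S) :
    X ∩ Set.Iio g = Set.Ico a g ∩ S ∩ X := by
  ext x
  exact ⟨fun ⟨hx, hxg⟩ => ⟨⟨⟨ha.2 (hXS hx), hxg⟩, hXS hx⟩, hx⟩, fun ⟨hx, hxX⟩ => ⟨hxX, hx.1.2⟩⟩

theorem finite_gaps (ha : IsLeast S a) (hS : Set.Ici g ⊆ S) : (gaps S).Finite :=
  gaps_eq_Ico_diff ha hS ▸ (Set.finite_Ico a g).sdiff

theorem finite_diff_of_Ici_subset (ha : IsLeast S a) (hX : Set.Ici g ⊆ X) : (S \ X).Finite :=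
  diff_eq_Ico_inter_diff ha hX ▸ ((Set.finite_Ico a g).inter_of_left S).sdiff

theorem finite_inter_Iio (ha : IsLeast S a) (hXS : X ⊆ S) : (X ∩ Set.Iio g).Finite :=
  inter_Iio_eq_Ico_inter_inter ha hXS ▸ ((Set.finite_Ico a g).inter_of_left S).inter_of_left X

theorem ncard_gaps_add_ncard_diff_add_ncard (ha : IsLeast S a) (hXS : X ⊆ S)
    (hX : Set.Ici g ⊆ X) :
    ((gaps S).ncard : ℤ) + (S \ X).ncard + (X ∩ Set.Iio g).ncard = g - a := by
  have hag : a ≤ g := ha.2 (hXS (hX Set.self_mem_Ici))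
  have hI := Set.finite_Ico a g
  have hcard : (X ∩ Set.Iio g).ncard + (S \ X).ncard + (gaps S).ncard = (Set.Ico a g).ncard := by
    rw [gaps_eq_Ico_diff ha (hX.trans hXS), diff_eq_Ico_inter_diff ha hX,
      inter_Iio_eq_Ico_inter_inter ha hXS,
      Set.ncard_inter_add_ncard_sdiff_eq_ncard _ _ (hI.inter_of_left S),
      Set.ncard_inter_add_ncard_sdiff_eq_ncard _ _ hI]
  rw [← Finset.coe_Ico, Set.ncard_coe_finset, Int.card_Ico] at hcard
  lia

end Order

section Length

variable {R K L : Type*} [CommRing R] [AddCommGroup K] [Module R K] [AddCommGroup L] [Module R L]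

theorem length_quotient_inf_submoduleOf (M A B : Submodule R K) :
    Module.length R (M ⧸ (A ⊓ B).submoduleOf M) =
      Module.length R (↥(M ⊓ A) ⧸ B.submoduleOf (M ⊓ A)) +
        Module.length R (M ⧸ A.submoduleOf M) := by
  have hle : (A ⊓ B).submoduleOf M ≤ A.submoduleOf M := Submodule.comap_mono inf_le_left
  let f := ((A ⊓ B).submoduleOf M).mkQ ∘ₗ Submodule.inclusion (inf_le_left : M ⊓ A ≤ M)
  have hker : LinearMap.ker f = B.submoduleOf (M ⊓ A) := by
    ext x
    exact (Submodule.Quotient.mk_eq_zero _).trans (and_iff_right x.2.2)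
  have hrange : LinearMap.range f = LinearMap.ker (Submodule.factor hle) := by
    rw [LinearMap.range_comp, Submodule.range_inclusion, Submodule.factor,
      Submodule.ker_mapQ, Submodule.comap_id]
    congr 1
    ext x
    exact and_iff_right x.2
  rw [Module.length_eq_add_of_exact (LinearMap.ker (Submodule.factor hle)).subtype _
      (Submodule.subtype_injective _) (Submodule.factor_surjective hle)
      (LinearMap.exact_subtype_ker_map _), ← hrange, ← hker, f.quotKerEquivRange.length_eq]

theorem length_quotient_comap_submoduleOf (f : K →ₗ[R] L) (M : Submodule R K)
    (T : Submodule R L) :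
    Module.length R (M ⧸ (T.comap f).submoduleOf M) =
      Module.length R (M.map f ⧸ T.submoduleOf (M.map f)) := by
  let g := (T.submoduleOf (M.map f)).mkQ ∘ₗ f.submoduleMap M
  have hg : Function.Surjective g :=
    (Submodule.mkQ_surjective _).comp (f.submoduleMap_surjective M)
  have hker : LinearMap.ker g = (T.comap f).submoduleOf M := by
    ext x
    exact Submodule.Quotient.mk_eq_zero _
  rw [← hker, (g.quotKerEquivOfSurjective hg).length_eq]

theorem length_quotient_iInf_submoduleOf_ne_top {κ : Type*} [Finite κ] {M : Submodule R K}
    {A : κ → Submodule R K} (hA : ∀ i, Module.length R (M ⧸ (A i).submoduleOf M) ≠ ⊤) :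
    Module.length R (M ⧸ (⨅ i, A i).submoduleOf M) ≠ ⊤ := by
  have := Fintype.ofFinite κ
  let f := LinearMap.pi fun i => ((A i).submoduleOf M).mkQ
  have hker : LinearMap.ker f = (⨅ i, A i).submoduleOf M := by
    rw [LinearMap.ker_pi, Submodule.submoduleOf, Submodule.comap_iInf]
    exact iInf_congr fun i => Submodule.ker_mkQ _
  rw [← hker]
  refine ne_top_of_le_ne_top ?_ (Module.length_le_of_injective
    (f.range.subtype ∘ₗ f.quotKerEquivRange.toLinearMap)
    ((Submodule.subtype_injective _).comp f.quotKerEquivRange.injective))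
  rw [Module.length_pi_of_fintype]
  exact WithTop.sum_ne_top.mpr fun i _ => hA i

end Length

/-! ### Orders for one valuation -/

section SingleValuation

variable {R K : Type*} [CommRing R] [CommRing K] [Algebra R K]

/-- The `R`-submodule of the elements of `K` of order at least `x` for a valuation that is
nonnegative on `R`. -/
def ball (v : Valuation K ℤᵐ⁰) (hv : ∀ a : R, v (algebraMap R K a) ≤ 1) (x : ℤ) :
    Submodule R K where
  carrier := {h | v h ≤ WithZero.exp (-x)}
  zero_mem' := (map_zero v).trans_le zero_le
  add_mem' := v.map_add_le
  smul_mem' a h hh := by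
    rw [Algebra.smul_def]
    exact (v.map_mul _ _).trans_le ((mul_le_of_le_one_left' (hv a)).trans hh)

/-- The finite orders of the elements of `M` for a single valuation, including those of zero
divisors. -/
def orders (v : Valuation K ℤᵐ⁰) (M : Submodule R K) : Set ℤ :=
  {x | ∃ h ∈ M, v h = WithZero.exp (-x)}

theorem lt_exp_neg_iff_le {z : ℤᵐ⁰} {n : ℤ} :
    z < WithZero.exp (-n) ↔ z ≤ WithZero.exp (-(n + 1)) := by
  rw [← WithZero.lt_mul_exp_iff_le WithZero.exp_ne_zero, ← WithZero.exp_add,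
    neg_add, neg_add_cancel_right]

theorem le_of_mem_orders {v : Valuation K ℤᵐ⁰} {M : Submodule R K} {b x : ℤ}
    (hb : ∀ h ∈ M, v h ≤ WithZero.exp (-b)) (hx : x ∈ orders v M) : b ≤ x := by
  obtain ⟨h, hh, hhx⟩ := hx
  exact neg_le_neg_iff.mp (WithZero.exp_le_exp.mp (hhx.symm.trans_le (hb h hh)))

namespace IsResiduallyRational

variable [IsLocalRing R] {v : Valuation K ℤᵐ⁰} (hv : IsResiduallyRational R v)
include hv

theorem map_smul_le (a : R) (x : K) : v (a • x) ≤ v x := by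
  rw [Algebra.smul_def, map_mul]
  exact mul_le_of_le_one_left' (hv.le_one a)

theorem map_smul_of_isUnit {a : R} (ha : IsUnit a) (x : K) : v (a • x) = v x := by
  refine (hv.map_smul_le a x).antisymm ?_
  obtain ⟨u, rfl⟩ := ha
  simpa only [Units.smul_def, smul_smul, Units.inv_mul, one_smul] using
    hv.map_smul_le (↑u⁻¹ : R) ((u : R) • x)

theorem map_smul_lt {a : R} (ha : a ∈ maximalIdeal R) {x : K} (hx : v x ≠ 0) :
    v (a • x) < v x := by
  rw [Algebra.smul_def, map_mul]
  exact mul_lt_of_lt_one_left (zero_lt_iff.mpr hx) (hv.lt_one a ha)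

theorem exists_isUnit_sub_smul_lt {x y : K} (hxy : v x = v y) (hy : v y ≠ 0) :
    ∃ u : R, IsUnit u ∧ v (x - u • y) < v y := by
  obtain ⟨a, ha⟩ := hv.exists_sub_smul_lt hxy.le hy
  refine ⟨a, of_not_not fun hu => lt_irrefl (v y) ?_, ha⟩
  have hsum := v.map_add_lt ha (hv.map_smul_lt ((mem_maximalIdeal a).mpr hu) hy)
  rwa [sub_add_cancel, hxy] at hsum

theorem isSimpleModule_quotient_ball {N : Submodule R K} {x : ℤ} (hN : N ≤ ball v hv.le_one x)
    (hx : x ∈ orders v N) :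
    IsSimpleModule R (N ⧸ (ball v hv.le_one (x + 1)).submoduleOf N) := by
  have hmem (g : N) : g ∈ (ball v hv.le_one (x + 1)).submoduleOf N ↔
      v g < WithZero.exp (-x) := lt_exp_neg_iff_le.symm
  rw [isSimpleModule_iff_toSpanSingleton_surjective]
  obtain ⟨h, hh, hhx⟩ := hx
  refine ⟨⟨Submodule.Quotient.mk ⟨h, hh⟩, 0, ?_⟩, fun m hm q => ?_⟩
  · rw [Ne, Submodule.Quotient.mk_eq_zero, hmem]
    exact hhx.not_lt
  obtain ⟨m, rfl⟩ := Submodule.Quotient.mk_surjective _ m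
  obtain ⟨q, rfl⟩ := Submodule.Quotient.mk_surjective _ q
  rw [Ne, Submodule.Quotient.mk_eq_zero, hmem, not_lt] at hm
  have hmx : v m = WithZero.exp (-x) := (hN m.2).antisymm hm
  obtain ⟨a, ha⟩ := hv.exists_sub_smul_lt ((hN q.2).trans hm) (hmx ▸ WithZero.exp_ne_zero)
  refine ⟨a, ?_⟩
  rw [LinearMap.toSpanSingleton_apply, ← Submodule.Quotient.mk_smul, eq_comm,
    Submodule.Quotient.eq, hmem]
  exact ha.trans_eq hmx

theorem subsingleton_quotient_ball {N : Submodule R K} {x : ℤ} (hN : N ≤ ball v hv.le_one x)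
    (hx : x ∉ orders v N) :
    Subsingleton (N ⧸ (ball v hv.le_one (x + 1)).submoduleOf N) := by
  refine Submodule.Quotient.subsingleton_iff.mpr (eq_top_iff.mpr fun g _ => ?_)
  exact lt_exp_neg_iff_le.mp ((hN g.2).lt_of_ne fun h => hx ⟨g, g.2, h⟩)

theorem length_quotient_ball_add_one {N : Submodule R K} {x : ℤ}
    (hN : N ≤ ball v hv.le_one x) :
    Module.length R (N ⧸ (ball v hv.le_one (x + 1)).submoduleOf N) =
      (orders v N ∩ {x}).encard := by
  by_cases hx : x ∈ orders v N
  · have := hv.isSimpleModule_quotient_ball hN hx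
    rw [Set.inter_singleton_of_mem hx, Set.encard_singleton, Module.length_eq_one]
  · have := hv.subsingleton_quotient_ball hN hx
    rw [Set.inter_singleton_of_notMem hx, Set.encard_empty, Module.length_eq_zero]

theorem length_quotient_ball {N : Submodule R K} {a : ℤ} (hN : N ≤ ball v hv.le_one a) (x : ℤ) :
    Module.length R (N ⧸ (ball v hv.le_one x).submoduleOf N) =
      (orders v N ∩ Set.Iio x).encard := by
  have hball : Antitone (ball v hv.le_one) := fun x y hxy h hh =>
    le_trans (α := ℤᵐ⁰) hh (WithZero.exp_le_exp.mpr (neg_le_neg hxy))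
  have hlow : ∀ y ∈ orders v N, a ≤ y := fun y => le_of_mem_orders fun h hh => hN hh
  obtain ⟨m, hma, hmx⟩ : ∃ m ≤ a, m ≤ x := ⟨min a x, min_le_left _ _, min_le_right _ _⟩
  induction x, hmx using Int.leInduction with
  | base =>
    have hempty : orders v N ∩ Set.Iio m = ∅ := Set.eq_empty_of_forall_notMem
      fun y hy => (hy.2.trans_le hma).not_ge (hlow y hy.1)
    rw [hempty, Set.encard_empty, Module.length_eq_zero_iff, Submodule.Quotient.subsingleton_iff,
      Submodule.submoduleOf_eq_top]
    exact hN.trans (hball hma)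
  | succ x _ ih =>
    have horders : orders v (N ⊓ ball v hv.le_one x) ∩ {x} = orders v N ∩ {x} := by
      ext y
      refine and_congr_left fun hy => ⟨fun ⟨h, hh, hhy⟩ => ⟨h, hh.1, hhy⟩,
        fun ⟨h, hh, hhy⟩ => ⟨h, ⟨hh, ?_⟩, hhy⟩⟩
      exact (hhy.trans (congrArg _ (congrArg _ hy))).le
    rw [← inf_eq_right.mpr (hball (Int.le_add_one le_rfl : x ≤ x + 1)),
      length_quotient_inf_submoduleOf, hv.length_quotient_ball_add_one inf_le_right, horders, ih,
      Set.Iio_add_one_eq_Iic, ← Set.Iio_insert, Set.insert_eq, Set.inter_union_distrib_left,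
      Set.encard_union_eq]
    exact Set.disjoint_left.mpr fun y hy hy' => hy'.2.ne hy.2

end IsResiduallyRational

end SingleValuation

/-! ### Orders for a family of valuations -/

section Families

theorem exp_neg_antitone : Antitone fun n : ℤ => (WithZero.exp (-n) : ℤᵐ⁰) := fun _ _ h =>
  WithZero.exp_le_exp.mpr (neg_le_neg h)

variable {R K : Type*} [CommRing R] [CommRing K] [Algebra R K] {ι : Type}
  {w : ι → Valuation K ℤᵐ⁰} {M : Submodule R K}

/-- The elements of order at least `c i` for every valuation `w i`. -/
def box (w : ι → Valuation K ℤᵐ⁰) (c : ι → ℤ) : Set K :=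
  {h | ∀ i, w i h ≤ WithZero.exp (-c i)}

/-- The vectors of orders of the elements of `M` all of whose orders are finite. -/
def orderSet (w : ι → Valuation K ℤᵐ⁰) (M : Submodule R K) : Set (ι → ℤ) :=
  {α | ∃ h ∈ M, ∀ i, w i h = WithZero.exp (-α i)}

/-- An `R`-submodule of `K` that lies between two boxes, as regular fractional ideals do. -/
structure IsLattice (w : ι → Valuation K ℤᵐ⁰) (M : Submodule R K) : Prop where
  exists_subset_box : ∃ b, (M : Set K) ⊆ box w b
  exists_box_subset : ∃ c, box w c ⊆ M

theorem box_antitone : Antitone (box w) := fun _ _ h _ hx i =>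
  (hx i).trans (exp_neg_antitone (h i))

theorem mem_lowerBounds_orderSet {b : ι → ℤ} (hb : (M : Set K) ⊆ box w b) :
    b ∈ lowerBounds (orderSet w M) := fun _ ⟨_, hh, hα⟩ i =>
  le_of_mem_orders (fun _ hg => hb hg i) ⟨_, hh, hα i⟩

theorem isCofinal_orderSet_subtype (hM : IsCofinal (orderSet w M)) (J : Finset ι) :
    IsCofinal (orderSet (fun j : J => w j) M) := by
  intro β
  obtain ⟨α, ⟨h, hh, hα⟩, hβα⟩ := hM (Function.extend Subtype.val β 0)
  refine ⟨fun j => α j, ⟨h, hh, fun j => hα j⟩, fun j => ?_⟩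
  exact (Subtype.val_injective.extend_apply β 0 j).symm.trans_le (hβα j)

theorem map_eq_one_of_map_one_sub_eq_zero {v : Valuation K ℤᵐ⁰} {e : K} (he : v (1 - e) = 0) :
    v e = 1 := by
  rw [← v.map_one, ← sub_sub_cancel 1 e, v.map_sub_eq_of_lt_left]
  rw [he, v.map_one]
  exact zero_lt_one

variable [IsLocalRing R]

theorem IsResiduallyRational.map_add_smul_le {v : Valuation K ℤᵐ⁰}
    (hv : IsResiduallyRational R v) (a : R) (x y : K) : v (x + a • y) ≤ max (v x) (v y) :=
  (v.map_add _ _).trans (max_le_max_left _ (hv.map_smul_le a y))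

theorem IsResiduallyRational.map_add_smul_eq_max_or {v : Valuation K ℤᵐ⁰}
    (hv : IsResiduallyRational R v) {a b : R} (hab : IsUnit (a - b)) (x y : K) :
    v (x + a • y) = max (v x) (v y) ∨ v (x + b • y) = max (v x) (v y) := by
  obtain hyx | hxy := lt_or_ge (v y) (v x)
  · exact .inl (by rw [max_eq_left hyx.le,
      v.map_add_eq_of_lt_left ((hv.map_smul_le a y).trans_lt hyx)])
  by_contra! hne
  have hlt := v.map_sub_lt ((hv.map_add_smul_le a x y).lt_of_ne hne.1)
    ((hv.map_add_smul_le b x y).lt_of_ne hne.2)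
  rw [add_sub_add_left_eq_sub, ← sub_smul, hv.map_smul_of_isUnit hab, max_eq_right hxy] at hlt
  exact hlt.false

theorem IsResiduallyRational.eq_max_or_map_add_smul_eq_max {v : Valuation K ℤᵐ⁰}
    (hv : IsResiduallyRational R v) (a : R) (x y : K) :
    v y = max (v x) (v y) ∨ v (x + a • y) = max (v x) (v y) := by
  obtain hyx | hxy := lt_or_ge (v y) (v x)
  · exact .inr (by rw [max_eq_left hyx.le,
      v.map_add_eq_of_lt_left ((hv.map_smul_le a y).trans_lt hyx)])
  · exact .inl (max_eq_right hxy).symm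

namespace IsBranchSystem

theorem subtype (hw : IsBranchSystem R w) (J : Finset ι) :
    IsBranchSystem R (fun j : J => w j) where
  isResiduallyRational j := hw.isResiduallyRational j
  exists_proj j := by
    obtain ⟨e, he, he'⟩ := hw.exists_proj j
    exact ⟨e, he, fun i hi => he' i fun h => hi (Subtype.ext h)⟩
  exists_eq_exp j := hw.exists_eq_exp j
  card_le := (ENat.card_le_card_of_injective Subtype.val_injective).trans hw.card_le

/-- The candidates `y` and `x + a • y`, with `a` running through representatives of the residue
field, are one more than the valuations, and each valuation excludes at most one of them. -/
theorem exists_mem_map_eq_max [Finite ι] (hw : IsBranchSystem R w) {x y : K} (hx : x ∈ M)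
    (hy : y ∈ M) : ∃ z ∈ M, ∀ i, w i z = max (w i x) (w i y) := by
  choose t ht using residue_surjective (R := R)
  let z : Option (ResidueField R) → K := fun k => k.elim y fun k => x + t k • y
  have hzM : ∀ k, z k ∈ M := fun k => by
    cases k with
    | none => exact hy
    | some k => exact M.add_mem hx (M.smul_mem _ hy)
  suffices ∃ k, ∀ i, w i (z k) = max (w i x) (w i y) from this.imp' z fun k hk => ⟨hzM k, hk⟩
  by_contra! hbad
  choose f hf using hbad
  have hinj : Function.Injective f := by
    rintro (_ | k) (_ | l) hkl
    · rfl
    · exact (((hw.isResiduallyRational _).eq_max_or_map_add_smul_eq_max (t l) x y).elim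
        (hf none) (hkl ▸ hf (some l))).elim
    · exact (((hw.isResiduallyRational _).eq_max_or_map_add_smul_eq_max (t k) x y).elim
        (hkl ▸ hf none) (hf (some k))).elim
    · by_contra hne
      have hunit : IsUnit (t k - t l) := by
        rw [← residue_ne_zero_iff_isUnit, map_sub, ht, ht, sub_ne_zero]
        exact fun h => hne (congrArg some h)
      exact ((hw.isResiduallyRational _).map_add_smul_eq_max_or hunit x y).elim
        (hf (some k)) (hkl ▸ hf (some l))
  have : Finite (Option (ResidueField R)) := .of_injective f hinj
  have : Finite (ResidueField R) := .of_injective some (Option.some_injective _)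
  have hcard := hw.card_le
  rw [ENat.card_eq_coe_natCard, ENat.card_eq_coe_natCard, Nat.cast_le] at hcard
  have hcard' := Nat.card_le_card_of_injective f hinj
  rw [Finite.card_option] at hcard'
  lia

theorem infClosed_orderSet [Finite ι] (hw : IsBranchSystem R w) : InfClosed (orderSet w M) := by
  rintro α ⟨x, hx, hxα⟩ β ⟨y, hy, hyβ⟩
  obtain ⟨z, hz, hzw⟩ := hw.exists_mem_map_eq_max hx hy
  refine ⟨z, hz, fun i => ?_⟩
  rw [hzw, hxα, hyβ]
  exact (exp_neg_antitone.map_inf (α i) (β i)).symm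

theorem exists_map_eq_exp_and_eq_zero (hw : IsBranchSystem R w) (i : ι) (n : ℤ) :
    ∃ x, w i x = WithZero.exp n ∧ ∀ j, j ≠ i → w j x = 0 := by
  obtain ⟨e, he, he'⟩ := hw.exists_proj i
  obtain ⟨x, hx⟩ := hw.exists_eq_exp i n
  refine ⟨e * x, ?_, fun j hj => ?_⟩
  · rw [map_mul, map_eq_one_of_map_one_sub_eq_zero he, one_mul, hx]
  · rw [map_mul, he' j hj, zero_mul]

theorem exists_forall_map_eq_exp [Finite ι] (hw : IsBranchSystem R w) (α : ι → ℤ) :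
    ∃ x, ∀ i, w i x = WithZero.exp (α i) := by
  classical
  have := Fintype.ofFinite ι
  choose x hx hx' using fun i => hw.exists_map_eq_exp_and_eq_zero i (α i)
  refine ⟨∑ i, x i, fun i => ?_⟩
  have hrest : w i (∑ j ∈ Finset.univ.erase i, x j) < w i (x i) := by
    rw [hx]
    refine (w i).map_sum_lt WithZero.exp_ne_zero fun j hj => ?_
    rw [hx' j i (Finset.ne_of_mem_erase hj).symm]
    exact WithZero.exp_pos
  rw [← Finset.add_sum_erase _ _ (Finset.mem_univ i), (w i).map_add_eq_of_lt_left hrest, hx]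

theorem Ici_subset_orderSet [Finite ι] (hw : IsBranchSystem R w) {c : ι → ℤ}
    (hc : box w c ⊆ M) : Set.Ici c ⊆ orderSet w M := fun α hα => by
  obtain ⟨x, hx⟩ := hw.exists_forall_map_eq_exp (-α)
  exact ⟨x, hc fun i => (hx i).trans_le (exp_neg_antitone (hα i)), hx⟩

theorem isCofinal_orderSet [Finite ι] (hw : IsBranchSystem R w) (hM : IsLattice w M) :
    IsCofinal (orderSet w M) := by
  obtain ⟨c, hc⟩ := hM.exists_box_subset
  exact fun β => ⟨β ⊔ c, hw.Ici_subset_orderSet hc (Set.mem_Ici.mpr le_sup_right), le_sup_left⟩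

/-- Adding a multiple of an element of large orders makes all orders of `h` finite, without changing
those below `N`. -/
theorem exists_mem_orderSet_forall_eq_or_le [Finite ι] (hw : IsBranchSystem R w)
    (hM : IsCofinal (orderSet w M)) {h : K} (hh : h ∈ M) (N : ι → ℤ) :
    ∃ α ∈ orderSet w M, ∀ i,
      w i h = WithZero.exp (-α i) ∨ w i h ≤ WithZero.exp (-N i) ∧ N i ≤ α i := by
  obtain ⟨β, ⟨y, hy, hyβ⟩, hNβ⟩ := hM N
  obtain ⟨z, hz, hzw⟩ := hw.exists_mem_map_eq_max hh hy
  have hz0 : ∀ i, w i z ≠ 0 := fun i => (WithZero.exp_pos.trans_le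
    ((hyβ i).symm.trans_le ((le_max_right _ _).trans_eq (hzw i).symm))).ne'
  have hzα : ∀ i, w i z = WithZero.exp (- -WithZero.log (w i z)) := fun i => by
    rw [neg_neg, WithZero.exp_log (hz0 i)]
  refine ⟨fun i => -WithZero.log (w i z), ⟨z, hz, hzα⟩, fun i => ?_⟩
  obtain hle | hlt := le_or_gt (w i h) (w i y)
  · refine .inr ⟨hle.trans ((hyβ i).trans_le (exp_neg_antitone (hNβ i))), ?_⟩
    change N i ≤ -WithZero.log (w i z)
    rw [hzw, max_eq_right hle, hyβ, WithZero.log_exp, neg_neg]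
    exact hNβ i
  · exact .inl ((max_eq_left hlt.le).symm.trans ((hzw i).symm.trans (hzα i)))

theorem image_eval_orderSet [Finite ι] (hw : IsBranchSystem R w) (hM : IsCofinal (orderSet w M))
    (i : ι) : Function.eval i '' orderSet w M = orders (w i) M := by
  ext x
  refine ⟨fun ⟨_, ⟨h, hh, hα⟩, hx⟩ => ⟨h, hh, hx ▸ hα i⟩, fun ⟨h, hh, hx⟩ => ?_⟩
  obtain ⟨α, hα, hhα⟩ := hw.exists_mem_orderSet_forall_eq_or_le hM hh fun _ => x + 1
  refine ⟨α, hα, ?_⟩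
  obtain heq | ⟨hle, -⟩ := hhα i
  · exact neg_injective (WithZero.exp_injective (heq.symm.trans hx))
  · exact ((lt_exp_neg_iff_le.mpr hle).ne hx).elim

theorem box_subset_of_box_update_subset [DecidableEq ι] (hw : IsBranchSystem R w) {d : ι → ℤ}
    (hd : d ∈ orderSet w M) {i : ι} (hi : box w (Function.update d i (d i + 1)) ⊆ M) :
    box w d ⊆ M := by
  have hlt : ∀ h ∈ box w d, w i h < WithZero.exp (-d i) → h ∈ M := fun h hh hhi => by
    refine hi fun j => ?_
    obtain rfl | hj := eq_or_ne j i
    · rw [Function.update_self]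
      exact lt_exp_neg_iff_le.mp hhi
    · rw [Function.update_of_ne hj]
      exact hh j
  intro h hh
  obtain hhi | hhi := (hh i).lt_or_eq
  · exact hlt h hh hhi
  obtain ⟨g, hg, hgd⟩ := hd
  obtain ⟨a, ha⟩ := (hw.isResiduallyRational i).exists_sub_smul_lt (hhi.trans (hgd i).symm).le
    (hgd i ▸ WithZero.exp_ne_zero)
  have hsub : h - a • g ∈ M := hlt _ (fun j => (w j).map_sub_le (hh j)
    (((hw.isResiduallyRational j).map_smul_le a g).trans (hgd j).le)) (ha.trans_eq (hgd i))
  exact sub_add_cancel h (a • g) ▸ M.add_mem hsub (M.smul_mem a hg)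

theorem exists_isLeast_orderSet [Finite ι] (hw : IsBranchSystem R w) (hM : IsLattice w M) :
    ∃ α, IsLeast (orderSet w M) α := by
  classical
  have := Fintype.ofFinite ι
  obtain ⟨b, hb⟩ := hM.exists_subset_box
  exact exists_isLeast_of_infClosed (hw.isCofinal_orderSet hM).nonempty hw.infClosed_orderSet
    ⟨b, mem_lowerBounds_orderSet hb⟩

theorem exists_isConductor_orderSet [Finite ι] (hw : IsBranchSystem R w)
    (hM : IsLattice w M) : ∃ c, IsConductor (orderSet w M) c := by
  classical
  have := Fintype.ofFinite ι
  obtain ⟨b, hb⟩ := hM.exists_subset_box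
  obtain ⟨c, hc⟩ := hM.exists_box_subset
  have hc' := hw.Ici_subset_orderSet hc
  refine exists_isLeast_of_infClosed ⟨c, hc' Set.self_mem_Ici, fun β hβ => hc' hβ⟩ ?_
    ⟨b, fun δ hδ => mem_lowerBounds_orderSet hb hδ.1⟩
  rintro δ ⟨hδ, hδE⟩ ε ⟨hε, hεE⟩
  refine ⟨hw.infClosed_orderSet hδ hε, fun β hβ => ?_⟩
  rw [← sup_eq_left.mpr hβ, sup_inf_left]
  exact hw.infClosed_orderSet (hδE _ le_sup_right) (hεE _ le_sup_right)

theorem box_subset_of_Ici_subset_orderSet [Finite ι] (hw : IsBranchSystem R w)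
    (hM : IsLattice w M) {c : ι → ℤ} (hc : Set.Ici c ⊆ orderSet w M) : box w c ⊆ M := by
  classical
  have := Fintype.ofFinite ι
  obtain ⟨c', hc'⟩ := hM.exists_box_subset
  by_contra hcM
  obtain ⟨d, ⟨⟨hcd, hdc'⟩, hdM⟩, hmax⟩ := Set.Finite.exists_maximal
    (s := {d ∈ Set.Icc c (c ⊔ c') | ¬ box w d ⊆ M}) ((Set.finite_Icc _ _).subset fun d hd => hd.1)
    ⟨c, Set.left_mem_Icc.mpr le_sup_left, hcM⟩
  obtain ⟨i, hi⟩ : ∃ i, d i < c' i := by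
    by_contra! hle
    exact hdM ((box_antitone hle).trans hc')
  have hdi : d ≤ Function.update d i (d i + 1) :=
    le_update_iff.mpr ⟨Int.le_add_one le_rfl, fun _ _ => le_rfl⟩
  refine hdM (hw.box_subset_of_box_update_subset (hc hcd) (i := i) ?_)
  by_contra hupdate
  have hle := hmax ⟨⟨hcd.trans hdi, update_le_iff.mpr
    ⟨(Int.add_one_le_of_lt hi).trans le_sup_right, fun j _ => hdc' j⟩⟩, hupdate⟩ hdi i
  rw [Function.update_self] at hle
  lia

end IsBranchSystem

end Families

/-! ### Relative maximals -/

section RelativeMaximals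

variable {R K : Type*} [CommRing R] [CommRing K] [Algebra R K] {ι : Type}
  {w : ι → Valuation K ℤᵐ⁰} {M : Submodule R K} {β : ι → ℤ}

/-- Some element of `M` has order exactly `β j` for `j ∈ T` and order greater than `β j`, possibly
infinite, for `j ∉ T`. -/
def IsLeading (w : ι → Valuation K ℤᵐ⁰) (M : Submodule R K) (β : ι → ℤ) (T : Finset ι) : Prop :=
  ∃ h ∈ M, (∀ j ∈ T, w j h = WithZero.exp (-β j)) ∧ ∀ j ∉ T, w j h < WithZero.exp (-β j)

/-- The orders with respect to `w i` of the elements of `M` on which all other valuations vanish. -/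
def pureOrders (w : ι → Valuation K ℤᵐ⁰) (M : Submodule R K) (i : ι) : Set ℤ :=
  {x | ∃ h ∈ M, w i h = WithZero.exp (-x) ∧ ∀ j, j ≠ i → w j h = 0}

/-- The orders with respect to `w i` of the elements of `M` whose order for every other valuation
`w j` is at least `δ j`. -/
def ordersAbove (w : ι → Valuation K ℤᵐ⁰) (M : Submodule R K) (i : ι) (δ : ι → ℤ) : Set ℤ :=
  {x | ∃ h ∈ M, w i h = WithZero.exp (-x) ∧ ∀ j, j ≠ i → w j h ≤ WithZero.exp (-δ j)}

theorem pureOrders_subset_orders (i : ι) : pureOrders w M i ⊆ orders (w i) M :=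
  fun _ ⟨h, hh, hhx, _⟩ => ⟨h, hh, hhx⟩

theorem pureOrders_subset_ordersAbove (i : ι) (δ : ι → ℤ) :
    pureOrders w M i ⊆ ordersAbove w M i δ :=
  fun _ ⟨h, hh, hhx, h0⟩ => ⟨h, hh, hhx, fun j hj => (h0 j hj).trans_le zero_le⟩

theorem exists_eq_exp_of_mem_ordersAbove_update [DecidableEq ι] {i j : ι} (hji : j ≠ i)
    {δ : ι → ℤ} {x : ℤ} (hδ : x ∉ ordersAbove w M i δ)
    (hx : x ∈ ordersAbove w M i (Function.update δ j (δ j - 1))) :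
    ∃ h ∈ M, w i h = WithZero.exp (-x) ∧ w j h = WithZero.exp (-(δ j - 1)) ∧
      ∀ k, k ≠ i → k ≠ j → w k h ≤ WithZero.exp (-δ k) := by
  obtain ⟨h, hh, hhx, hle⟩ := hx
  have hk (k : ι) (hki : k ≠ i) (hkj : k ≠ j) : w k h ≤ WithZero.exp (-δ k) := by
    simpa only [Function.update_of_ne hkj] using hle k hki
  have hj : w j h ≤ WithZero.exp (-(δ j - 1)) := by
    simpa only [Function.update_self] using hle j hji
  refine ⟨h, hh, hhx, hj.eq_of_not_lt fun hlt => hδ ⟨h, hh, hhx, fun k hki => ?_⟩, hk⟩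
  obtain rfl | hkj := eq_or_ne k j
  · rwa [lt_exp_neg_iff_le, sub_add_cancel] at hlt
  · exact hk k hki hkj

variable [IsLocalRing R]

namespace IsBranchSystem

theorem Ici_subset_pureOrders (hw : IsBranchSystem R w) {c : ι → ℤ} (hc : box w c ⊆ M) (i : ι) :
    Set.Ici (c i) ⊆ pureOrders w M i := fun x hx => by
  obtain ⟨h, hi, h0⟩ := hw.exists_map_eq_exp_and_eq_zero i (-x)
  refine ⟨h, hc fun j => ?_, hi, h0⟩
  obtain rfl | hj := eq_or_ne j i
  · exact hi.trans_le (exp_neg_antitone hx)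
  · exact (h0 j hj).trans_le zero_le

theorem ordersAbove_eq_pureOrders (hw : IsBranchSystem R w) {c : ι → ℤ} (hc : box w c ⊆ M)
    (i : ι) : ordersAbove w M i c = pureOrders w M i := by
  refine (pureOrders_subset_ordersAbove i c).antisymm' fun x ⟨h, hh, hhx, hhc⟩ => ?_
  obtain ⟨e, he, he'⟩ := hw.exists_proj i
  have hrest : (1 - e) * h ∈ M := by
    refine hc fun j => ?_
    rw [map_mul]
    obtain rfl | hj := eq_or_ne j i
    · rw [he, zero_mul]
      exact zero_le
    · rw [(w j).map_sub_eq_of_lt_left (by rw [he' j hj, map_one]; exact zero_lt_one), map_one,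
        one_mul]
      exact hhc j hj
  refine ⟨e * h, ?_, ?_, fun j hj => ?_⟩
  · rw [sub_mul, one_mul] at hrest
    exact sub_sub_cancel h (e * h) ▸ M.sub_mem hh hrest
  · rw [map_mul, map_eq_one_of_map_one_sub_eq_zero he, one_mul, hhx]
  · rw [map_mul, he' j hj, zero_mul]

theorem supClosed_setOf_isLeading [DecidableEq ι] [Finite ι] (hw : IsBranchSystem R w) :
    SupClosed {T | IsLeading w M β T} := by
  rintro S ⟨x, hx, hxS, hxS'⟩ T ⟨y, hy, hyT, hyT'⟩
  obtain ⟨z, hz, hzw⟩ := hw.exists_mem_map_eq_max hx hy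
  have hxle : ∀ j, w j x ≤ WithZero.exp (-β j) := fun j =>
    (em (j ∈ S)).elim (fun hj => (hxS j hj).le) fun hj => (hxS' j hj).le
  have hyle : ∀ j, w j y ≤ WithZero.exp (-β j) := fun j =>
    (em (j ∈ T)).elim (fun hj => (hyT j hj).le) fun hj => (hyT' j hj).le
  refine ⟨z, hz, fun j hj => ?_, fun j hj => ?_⟩
  · rw [hzw]
    obtain hj | hj := Finset.mem_union.mp hj
    · rw [hxS j hj, max_eq_left (hyle j)]
    · rw [hyT j hj, max_eq_right (hxle j)]
  · rw [Finset.sup_eq_union, Finset.mem_union, not_or] at hj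
    exact (hzw j).trans_lt (max_lt (hxS' j hj.1) (hyT' j hj.2))

theorem isLeading_erase_of_inter_eq_singleton [DecidableEq ι] (hw : IsBranchSystem R w)
    {S T : Finset ι} {i : ι} (hS : IsLeading w M β S) (hT : IsLeading w M β T)
    (hST : S ∩ T = {i}) : IsLeading w M β ((S ∪ T).erase i) := by
  obtain ⟨x, hx, hxS, hxS'⟩ := hS
  obtain ⟨y, hy, hyT, hyT'⟩ := hT
  have hmem (j : ι) : j ∈ S ∧ j ∈ T ↔ j = i := by
    rw [← Finset.mem_inter, hST, Finset.mem_singleton]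
  obtain ⟨hiS, hiT⟩ := (hmem i).mpr rfl
  obtain ⟨a, ha, hlt⟩ := (hw.isResiduallyRational i).exists_isUnit_sub_smul_lt
    ((hxS i hiS).trans (hyT i hiT).symm) (hyT i hiT ▸ WithZero.exp_ne_zero)
  have hay (j : ι) : w j (a • y) = w j y := (hw.isResiduallyRational j).map_smul_of_isUnit ha y
  refine ⟨x - a • y, M.sub_mem hx (M.smul_mem a hy), fun j hj => ?_, fun j hj => ?_⟩
  · rw [Finset.mem_erase, Finset.mem_union] at hj
    obtain ⟨hji, hjS | hjT⟩ := hj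
    · have hjT : j ∉ T := fun hjT => hji ((hmem j).mp ⟨hjS, hjT⟩)
      rw [(w j).map_sub_eq_of_lt_left, hxS j hjS]
      rw [hay, hxS j hjS]
      exact hyT' j hjT
    · have hjS : j ∉ S := fun hjS => hji ((hmem j).mp ⟨hjS, hjT⟩)
      rw [(w j).map_sub_eq_of_lt_right, hay, hyT j hjT]
      rw [hay, hyT j hjT]
      exact hxS' j hjS
  · obtain rfl | hji := eq_or_ne j i
    · exact hlt.trans_eq (hyT j hiT)
    · rw [Finset.mem_erase, Finset.mem_union, not_and, not_or] at hj
      exact (w j).map_sub_lt (hxS' j (hj hji).1) ((hay j).trans_lt (hyT' j (hj hji).2))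

theorem fiber_nonempty_iff_isLeading [Finite ι] (hw : IsBranchSystem R w)
    (hM : IsCofinal (orderSet w M)) {T : Finset ι} :
    (fiber T (orderSet w M) β).Nonempty ↔ IsLeading w M β T := by
  constructor
  · rintro ⟨α, ⟨h, hh, hα⟩, hT, hT'⟩
    exact ⟨h, hh, fun j hj => (hα j).trans (by rw [hT j hj]), fun j hj => (hα j).trans_lt
      (WithZero.exp_lt_exp.mpr (neg_lt_neg (hT' j hj)))⟩
  · rintro ⟨h, hh, hT, hT'⟩
    obtain ⟨α, hα, hhα⟩ := hw.exists_mem_orderSet_forall_eq_or_le hM hh fun j => β j + 1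
    refine ⟨α, hα, fun j hj => ?_, fun j hj => ?_⟩
    · obtain heq | ⟨hle, -⟩ := hhα j
      · exact neg_injective (WithZero.exp_injective (heq.symm.trans (hT j hj)))
      · exact ((lt_exp_neg_iff_le.mpr hle).ne (hT j hj)).elim
    · obtain heq | ⟨-, hle⟩ := hhα j
      · exact neg_lt_neg_iff.mp (WithZero.exp_lt_exp.mp (heq.symm.trans_lt (hT' j hj)))
      · exact hle

theorem isLeading_of_forall_pair [DecidableEq ι] [Finite ι] (hw : IsBranchSystem R w)
    (hpair : ∀ i j, i ≠ j → IsLeading w M β {i, j}) {T : Finset ι} (hT : 2 ≤ T.card) :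
    IsLeading w M β T := by
  obtain ⟨t, ht, u, hu, htu⟩ := Finset.one_lt_card.mp hT
  have hne : (T.erase t).Nonempty := ⟨u, Finset.mem_erase.mpr ⟨htu.symm, hu⟩⟩
  have hTeq : T = (T.erase t).sup' hne fun j => {t, j} := by
    rw [Finset.sup'_eq_sup, Finset.sup_eq_biUnion]
    ext j
    simp only [Finset.mem_biUnion, Finset.mem_erase, Finset.mem_insert, Finset.mem_singleton]
    grind
  rw [hTeq]
  exact hw.supClosed_setOf_isLeading.finsetSup'_mem hne fun j hj =>
    hpair t j (Finset.ne_of_mem_erase hj).symm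

/-- All pairs are leading: `{i, j}` arises from `{r, i}` and `{r, j}` by cancelling leading terms at
`r`. A leading `{i}` with `i ≠ r` would, against `{r, i}`, make `{r}` leading. -/
theorem mem_relMaximals_of_isLeading [DecidableEq ι] [Finite ι] (hw : IsBranchSystem R w)
    (hM : IsCofinal (orderSet w M)) {r : ι} (hne : ∃ j, j ≠ r) (hr : ¬ IsLeading w M β {r})
    (hpair : ∀ j, j ≠ r → IsLeading w M β {r, j}) : β ∈ relMaximals (orderSet w M) := by
  have hpairs : ∀ i j, i ≠ j → IsLeading w M β {i, j} := fun i j hij => by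
    obtain rfl | hir := eq_or_ne i r
    · exact hpair j hij.symm
    obtain rfl | hjr := eq_or_ne j r
    · exact Finset.pair_comm i j ▸ hpair i hij
    have hinter : ({r, i} ∩ {r, j} : Finset ι) = {r} := by grind
    have hunion : (({r, i} ∪ {r, j} : Finset ι)).erase r = {i, j} := by grind
    exact hunion ▸ hw.isLeading_erase_of_inter_eq_singleton (hpair i hir) (hpair j hjr) hinter
  have hfiber : ∀ T : Finset ι, 2 ≤ T.card → (fiber T (orderSet w M) β).Nonempty := fun T hT =>
    (hw.fiber_nonempty_iff_isLeading hM).mpr (hw.isLeading_of_forall_pair hpairs hT)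
  refine ⟨⟨?_, fun i => Set.not_nonempty_iff_eq_empty.mp fun hi => ?_⟩, hfiber⟩
  · have := Fintype.ofFinite ι
    obtain ⟨j, hj⟩ := hne
    obtain ⟨α, hα, hαβ, -⟩ := hfiber Finset.univ (Finset.one_lt_card.mpr
      ⟨j, Finset.mem_univ j, r, Finset.mem_univ r, hj⟩)
    rwa [show β = α from funext fun i => (hαβ i (Finset.mem_univ i)).symm]
  · rw [hw.fiber_nonempty_iff_isLeading hM] at hi
    obtain rfl | hir := eq_or_ne i r
    · exact hr hi
    have hinter : ({r, i} ∩ {i} : Finset ι) = {i} := by grind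
    have hunion : (({r, i} ∪ {i} : Finset ι)).erase i = {r} := by grind
    exact hr (hunion ▸ hw.isLeading_erase_of_inter_eq_singleton (hpair i hir) hi hinter)


theorem notMem_pureOrders_of_mem_relMaximals [Finite ι] (hw : IsBranchSystem R w)
    (hM : IsCofinal (orderSet w M)) {J : Finset ι} {β : J → ℤ}
    (hβ : β ∈ relMaximals (orderSet (fun j : J => w j) M)) (i : J) :
    β i ∉ pureOrders w M i := by
  rintro ⟨h, hh, hi, h0⟩
  have hlead : IsLeading (fun j : J => w j) M β {i} := by
    refine ⟨h, hh, fun j hj => Finset.mem_singleton.mp hj ▸ hi, fun j hj => ?_⟩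
    rw [h0 j fun hji => hj (Finset.mem_singleton.mpr (Subtype.ext hji))]
    exact WithZero.exp_pos
  exact ((((hw.subtype J).fiber_nonempty_iff_isLeading
    (isCofinal_orderSet_subtype hM J)).mpr hlead).ne_empty) (hβ.1.2 i)

theorem exists_minimal_notMem_ordersAbove [Finite ι] [DecidableEq ι] (hw : IsBranchSystem R w)
    {b c : ι → ℤ} (hc : box w c ⊆ M) {i : ι} {x : ℤ} (hx : x ∉ pureOrders w M i) :
    ∃ δ, x ∉ ordersAbove w M i δ ∧
      ∀ j, b j < δ j → x ∈ ordersAbove w M i (Function.update δ j (δ j - 1)) := by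
  have := Fintype.ofFinite ι
  have hbc : x ∉ ordersAbove w M i (b ⊔ c) := by
    rwa [hw.ordersAbove_eq_pureOrders ((box_antitone le_sup_right).trans hc)]
  obtain ⟨δ, ⟨⟨hbδ, hδ⟩, hxδ⟩, hmin⟩ := Set.Finite.exists_minimal
    (s := {δ ∈ Set.Icc b (b ⊔ c) | x ∉ ordersAbove w M i δ})
    ((Set.finite_Icc _ _).subset fun δ hδ => hδ.1) ⟨b ⊔ c, ⟨le_sup_left, le_rfl⟩, hbc⟩
  refine ⟨δ, hxδ, fun j hj => ?_⟩
  by_contra hcon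
  have hle : Function.update δ j (δ j - 1) ≤ δ :=
    update_le_iff.mpr ⟨Int.sub_le_self _ zero_le_one, fun _ _ => le_rfl⟩
  have hmem : Function.update δ j (δ j - 1) ∈ Set.Icc b (b ⊔ c) :=
    ⟨le_update_iff.mpr ⟨Int.le_sub_one_of_lt hj, fun k _ => hbδ k⟩, hle.trans hδ⟩
  have hge := hmin ⟨hmem, hcon⟩ hle j
  rw [Function.update_self] at hge
  lia

theorem mem_relMaximals_of_mem_ordersAbove_update [DecidableEq ι] [Finite ι]
    (hw : IsBranchSystem R w) (hM : IsCofinal (orderSet w M)) {i s : ι} {J : Finset ι} (hi : i ∈ J)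
    (hs : s ∈ J) (hsi : s ≠ i) {δ : ι → ℤ} (hδ : ∀ h ∈ M, ∀ j ∉ J, w j h ≤ WithZero.exp (-δ j))
    {x : ℤ} (hxδ : x ∉ ordersAbove w M i δ)
    (hx : ∀ j ∈ J, j ≠ i → x ∈ ordersAbove w M i (Function.update δ j (δ j - 1))) :
    (Function.update (δ - 1) i x ∘ (↑) : J → ℤ) ∈ relMaximals (orderSet (fun j : J => w j) M) := by
  set β := Function.update (δ - 1) i x
  have hβi : β i = x := Function.update_self ..
  have hβ {j : ι} (hj : j ≠ i) : β j = δ j - 1 := Function.update_of_ne hj ..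
  have hlt {j : ι} (hj : j ≠ i) {z : ℤᵐ⁰} : z < WithZero.exp (-β j) ↔ z ≤ WithZero.exp (-δ j) := by
    rw [hβ hj, lt_exp_neg_iff_le, sub_add_cancel]
  refine (hw.subtype J).mem_relMaximals_of_isLeading (r := ⟨i, hi⟩)
    (isCofinal_orderSet_subtype hM J)
    ⟨⟨s, hs⟩, fun h => hsi (congrArg Subtype.val h)⟩ ?_ fun ⟨j, hj⟩ hji => ?_
  · rintro ⟨h, hh, hhi, hhlt⟩
    refine hxδ ⟨h, hh, hβi ▸ hhi ⟨i, hi⟩ (Finset.mem_singleton_self _), fun j hj => ?_⟩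
    by_cases hjJ : j ∈ J
    · exact (hlt hj).mp (hhlt ⟨j, hjJ⟩ (by simpa using hj))
    · exact hδ h hh j hjJ
  · have hji : j ≠ i := fun h => hji (Subtype.ext h)
    obtain ⟨h, hh, hhi, hhj, hle⟩ := exists_eq_exp_of_mem_ordersAbove_update hji hxδ (hx j hj hji)
    refine ⟨h, hh, fun k hk => ?_, fun k hk => ?_⟩
    · obtain rfl | rfl : k = ⟨i, hi⟩ ∨ k = ⟨j, hj⟩ := by simpa using hk
      · simpa only [Function.comp_apply, hβi] using hhi
      · simpa only [Function.comp_apply, hβ hji] using hhj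
    · simp only [Finset.mem_insert, Finset.mem_singleton, not_or, Subtype.ext_iff] at hk
      exact (hlt hk.1).mpr (hle k hk.1 hk.2)

theorem exists_mem_relMaximals [Finite ι] (hw : IsBranchSystem R w) (hM : IsLattice w M) {i : ι}
    {x : ℤ} (hx : x ∈ orders (w i) M) (hxi : x ∉ pureOrders w M i) :
    ∃ (J : Finset ι) (hJ : {i} ⊂ J), ∃ β ∈ relMaximals (orderSet (fun j : J => w j) M),
      x = β ⟨i, hJ.1 (Finset.mem_singleton_self i)⟩ := by
  classical
  have := Fintype.ofFinite ι
  obtain ⟨b, hb⟩ := hM.exists_subset_box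
  obtain ⟨c, hc⟩ := hM.exists_box_subset
  obtain ⟨δ, hxδ, hδ⟩ := hw.exists_minimal_notMem_ordersAbove (b := b) hc hxi
  let J : Finset ι := insert i {j : ι | b j < δ j}.toFinset
  have hmemJ {j : ι} (hj : j ≠ i) : j ∈ J ↔ b j < δ j := by simp [J, hj]
  have hiJ : i ∈ J := Finset.mem_insert_self ..
  have hδJ : ∀ h ∈ M, ∀ j ≠ i, j ∉ J → w j h ≤ WithZero.exp (-δ j) := fun h hh j hji hj =>
    (hb hh j).trans (exp_neg_antitone (not_lt.mp ((hmemJ hji).not.mp hj)))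
  obtain ⟨s, hsi, hs⟩ : ∃ s, s ≠ i ∧ s ∈ J := by
    obtain ⟨h, hh, hhx⟩ := hx
    by_contra! hle
    exact hxδ ⟨h, hh, hhx, fun j hj => hδJ h hh j hj (hle j hj)⟩
  refine ⟨J, (Finset.ssubset_iff_of_subset (Finset.singleton_subset_iff.mpr hiJ)).mpr
    ⟨s, hs, Finset.notMem_singleton.mpr hsi⟩, Function.update (δ - 1) i x ∘ (↑),
    hw.mem_relMaximals_of_mem_ordersAbove_update (hw.isCofinal_orderSet hM) hiJ hs hsi
      (fun h hh j hj => hδJ h hh j (fun hji => hj (hji ▸ hiJ)) hj) hxδ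
      fun j hj hji => hδ j ((hmemJ hji).mp hj), (Function.update_self i x (δ - 1)).symm⟩

end IsBranchSystem

theorem relMaximalCoords_orderSet {n : ℕ} {w : Fin n → Valuation K ℤᵐ⁰}
    (hw : IsBranchSystem R w) (hM : IsLattice w M) (i : Fin n) :
    relMaximalCoords (fun J => orderSet (fun j : J => w j) M) i =
      orders (w i) M \ pureOrders w M i := by
  ext x
  refine ⟨?_, fun ⟨hx, hxi⟩ => hw.exists_mem_relMaximals hM hx hxi⟩
  rintro ⟨J, hJ, β, hβ, rfl⟩
  obtain ⟨h, hh, hβh⟩ := hβ.1.1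
  exact ⟨⟨h, hh, hβh ⟨i, hJ.1 (Finset.mem_singleton_self i)⟩⟩,
    hw.notMem_pureOrders_of_mem_relMaximals (hw.isCofinal_orderSet hM) hβ
      ⟨i, hJ.1 (Finset.mem_singleton_self i)⟩⟩

end RelativeMaximals

/-! ### The length formula -/

section LengthFormula

variable {R K : Type*} [CommRing R] [IsLocalRing R] [CommRing K] [Algebra R K] {ι : Type}
  {w : ι → Valuation K ℤᵐ⁰} {M : Submodule R K}

namespace IsBranchSystem

theorem isLeast_orders [Finite ι] (hw : IsBranchSystem R w) (hM : IsLattice w M) {α₀ : ι → ℤ}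
    (hα₀ : IsLeast (orderSet w M) α₀) (i : ι) : IsLeast (orders (w i) M) (α₀ i) :=
  hw.image_eval_orderSet (hw.isCofinal_orderSet hM) i ▸ (Function.monotone_eval i).map_isLeast hα₀

theorem length_quotient_iInf_ball_ne_top (hw : IsBranchSystem R w) (hM : IsLattice w M)
    (γ : ι → ℤ) (J : Finset ι) :
    Module.length R (M ⧸ (⨅ j : J, ball (w j) (hw.isResiduallyRational j).le_one
      (γ j)).submoduleOf M) ≠ ⊤ := by
  obtain ⟨b, hb⟩ := hM.exists_subset_box
  refine length_quotient_iInf_submoduleOf_ne_top fun j => ?_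
  rw [(hw.isResiduallyRational j).length_quotient_ball (fun h hh => hb hh j)]
  refine Set.encard_ne_top_iff.mpr ((Set.finite_Ico (b j) (γ j)).subset fun x hx => ⟨?_, hx.2⟩)
  exact le_of_mem_orders (fun h hh => hb hh j) hx.1

theorem length_quotient_iInf_ball [Fintype ι] [DecidableEq ι] (hw : IsBranchSystem R w)
    (hM : IsLattice w M) {γ : ι → ℤ} (hγ : box w γ ⊆ M) (i : ι) :
    Module.length R (M ⧸ (⨅ j, ball (w j) (hw.isResiduallyRational j).le_one
        (γ j)).submoduleOf M) =
      (pureOrders w M i ∩ Set.Iio (γ i)).encard +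
        Module.length R (M ⧸ (⨅ j : ({i}ᶜ : Finset ι), ball (w j)
          (hw.isResiduallyRational j).le_one (γ j)).submoduleOf M) := by
  obtain ⟨b, hb⟩ := hM.exists_subset_box
  set B := fun j => ball (w j) (hw.isResiduallyRational j).le_one (γ j)
  have hmem (h : K) : h ∈ ⨅ j : ({i}ᶜ : Finset ι), B j ↔
      ∀ j, j ≠ i → w j h ≤ WithZero.exp (-γ j) := by
    simp only [Submodule.mem_iInf, Subtype.forall, Finset.mem_compl, Finset.mem_singleton]
    rfl
  have hsplit : ⨅ j, B j = (⨅ j : ({i}ᶜ : Finset ι), B j) ⊓ B i := by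
    rw [iInf_split_single B i, inf_comm, iInf_subtype]
    simp only [Finset.mem_compl, Finset.mem_singleton]
  have horders : orders (w i) (M ⊓ ⨅ j : ({i}ᶜ : Finset ι), B j) = pureOrders w M i := by
    rw [← hw.ordersAbove_eq_pureOrders hγ]
    ext x
    exact ⟨fun ⟨h, hh, hx⟩ => ⟨h, hh.1, hx, (hmem h).mp hh.2⟩,
      fun ⟨h, hh, hx, hle⟩ => ⟨h, ⟨hh, (hmem h).mpr hle⟩, hx⟩⟩
  have hN : M ⊓ ⨅ j : ({i}ᶜ : Finset ι), B j ≤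
      ball (w i) (hw.isResiduallyRational i).le_one (b i) := fun h hh => hb hh.1 i
  rw [hsplit, length_quotient_inf_submoduleOf,
    (hw.isResiduallyRational i).length_quotient_ball hN, horders]

end IsBranchSystem

end LengthFormula

section ValueSets

theorem ne_zero_and_eq_neg_log_iff {z : ℤᵐ⁰} {n : ℤ} :
    z ≠ 0 ∧ n = -WithZero.log z ↔ z = WithZero.exp (-n) := by
  constructor
  · rintro ⟨hz, rfl⟩
    rw [neg_neg, WithZero.exp_log hz]
  · rintro rfl
    exact ⟨WithZero.exp_ne_zero, by rw [WithZero.log_exp, neg_neg]⟩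

variable {R : Type u} [CommRing R] {L : Type u} [CommRing L] [Algebra R L] {ι : Type}
  {w : ι → Valuation L ℤᵐ⁰} {M : Submodule R L}

theorem valueSet_eq_orderSet (hM : ∀ h ∈ M, h ∈ L⁰ ↔ ∀ i, w i h ≠ 0) :
    valueSet w M = orderSet w M := by
  ext α
  refine exists_congr fun h => and_congr_right fun hh => ?_
  rw [hM h hh, ← forall_and]
  exact forall_congr' fun i => ne_zero_and_eq_neg_log_iff

theorem submoduleOf_truncation (hw : ∀ i (a : R), w i (algebraMap R L a) ≤ 1) (γ : ι → ℤ) :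
    (truncation w hw M γ).submoduleOf M = (⨅ i, ball (w i) (hw i) (γ i)).submoduleOf M := by
  ext h
  refine (and_iff_right h.2).trans ?_
  simp only [Submodule.submoduleOf, Submodule.mem_comap, Submodule.mem_iInf]
  rfl

end ValueSets

section FractionalIdeals

variable {R : Type u} [CommRing R] {r : ℕ} (P : Fin r ≃ minimalPrimes R)
  (M : FractionalIdeal R⁰ (FractionRing R))

theorem idealValueSet_eq [IsReduced R] :
    idealValueSet P M = orderSet (val P) (M : Submodule R (FractionRing R)) :=
  valueSet_eq_orderSet fun h _ => mem_nonZeroDivisors_fractionRing_iff P h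

theorem projValueSet_eq (J : Finset (Fin r)) : projValueSet P M J =
    orderSet (fun j : J => val P j) (M : Submodule R (FractionRing R)) := by
  rw [projValueSet, projIdeal, valueSet_eq_orderSet]
  · ext α
    simp only [orderSet, Set.mem_ofPred_eq, Submodule.mem_map, exists_exists_and_eq_and,
      partialVal_projPartial]
  · rintro _ ⟨h, -, rfl⟩
    simp only [projPartial_mem_nonZeroDivisors_iff, partialVal_projPartial, Subtype.forall]

theorem branchValueSet_eq (i : Fin r) : branchValueSet P M i =
    orders (val P i) (M : Submodule R (FractionRing R)) := by
  ext x
  rw [branchValueSet, projValueSet_eq]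
  refine ⟨?_, fun ⟨h, hh, hx⟩ => ⟨fun _ => x, ⟨h, hh, fun ⟨j, hj⟩ => ?_⟩, rfl⟩⟩
  · rintro ⟨β, ⟨h, hh, hβ⟩, rfl⟩
    exact ⟨h, hh, hβ ⟨i, Finset.mem_singleton_self i⟩⟩
  · obtain rfl := Finset.mem_singleton.mp hj
    exact hx

theorem colength_eq (γ : Fin r → ℤ) : colength P M γ =
    Module.length R ((M : Submodule R (FractionRing R)) ⧸
      (⨅ j, ball (val P j) (val_algebraMap_le_one P j) (γ j)).submoduleOf
        (M : Submodule R (FractionRing R))) := by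
  rw [colength, submoduleOf_truncation]

theorem projColength_eq (J : Finset (Fin r)) (δ : J → ℤ) : projColength P M J δ =
    Module.length R ((M : Submodule R (FractionRing R)) ⧸
      (⨅ j : J, ball (val P j) (val_algebraMap_le_one P j) (δ j)).submoduleOf
        (M : Submodule R (FractionRing R))) := by
  have hcomap : (⨅ j : J, ball (partialVal P J j) (partialVal_algebraMap_le_one P J j)
      (δ j)).comap (projPartial P J) =
        ⨅ j : J, ball (val P j) (val_algebraMap_le_one P j) (δ j) := by
    rw [Submodule.comap_iInf]
    refine iInf_congr fun j => Submodule.ext fun h => ?_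
    exact iff_of_eq (congrArg (· ≤ _) (partialVal_projPartial P J j h))
  rw [projColength, submoduleOf_truncation, ← hcomap, length_quotient_comap_submoduleOf]
  rfl

theorem projColength_ne_top [IsLocalRing R] (hw : IsBranchSystem R (val P))
    (hM : IsLattice (val P) (M : Submodule R (FractionRing R))) (γ : Fin r → ℤ)
    (J : Finset (Fin r)) : projColength P M J (fun j => γ j) ≠ ⊤ :=
  projColength_eq P M J _ ▸ hw.length_quotient_iInf_ball_ne_top hM γ J

theorem colength_eq_encard_add_projColength [IsLocalRing R] (hw : IsBranchSystem R (val P))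
    (hM : IsLattice (val P) (M : Submodule R (FractionRing R))) {γ : Fin r → ℤ}
    (hγ : box (val P) γ ⊆ (M : Submodule R (FractionRing R))) (i : Fin r) :
    colength P M γ =
      (pureOrders (val P) (M : Submodule R (FractionRing R)) i ∩ Set.Iio (γ i)).encard +
        projColength P M {i}ᶜ fun j => γ j := by
  rw [colength_eq, projColength_eq, hw.length_quotient_iInf_ball hM hγ i]

end FractionalIdeals

section Lattices

variable {R : Type u} [CommRing R] [IsLocalRing R] {r : ℕ} (P : Fin r ≃ minimalPrimes R)
  (M : FractionalIdeal R⁰ (FractionRing R))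

namespace IsCompleteAdmissible

theorem val_algebraMap_ne_zero (hR : IsCompleteAdmissible R) {d : R} (hd : d ∈ R⁰) (i : Fin r) :
    val P i (algebraMap R (FractionRing R) d) ≠ 0 := by
  have := hR.isReduced
  exact (mem_nonZeroDivisors_fractionRing_iff P _).mp
    (IsLocalization.map_units (FractionRing R) (⟨d, hd⟩ : R⁰)).mem_nonZeroDivisors i

theorem exists_subset_box (hR : IsCompleteAdmissible R) :
    ∃ b, ((M : Submodule R (FractionRing R)) : Set (FractionRing R)) ⊆ box (val P) b := by
  obtain ⟨d, hd, hdM⟩ := M.isFractional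
  refine ⟨fun i => WithZero.log (val P i (algebraMap R (FractionRing R) d)), fun h hh i => ?_⟩
  obtain ⟨a, ha⟩ := hdM h hh
  have hd0 := hR.val_algebraMap_ne_zero P hd i
  have hle := val_algebraMap_le_one P i a
  rw [ha, Algebra.smul_def, map_mul] at hle
  rwa [WithZero.exp_neg, WithZero.exp_log hd0, ← one_div, le_div_iff₀' (zero_lt_iff.mpr hd0)]

theorem exists_box_subset (hR : IsCompleteAdmissible R)
    (hM : ∃ d ∈ R⁰, algebraMap R (FractionRing R) d ∈ M) :
    ∃ c, box (val P) c ⊆ (M : Submodule R (FractionRing R)) := by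
  obtain ⟨m, hm, hmM⟩ := hM
  obtain ⟨d, hd, hrange⟩ := hR.exists_smul_mem_range_of_forall_val_le_one P
  have hunit := IsLocalization.map_units (FractionRing R) (⟨d * m, mul_mem hd hm⟩ : R⁰)
  obtain ⟨e, he : algebraMap R (FractionRing R) (d * m) * e = 1⟩ := hunit.exists_right_inv
  refine ⟨fun i => -WithZero.log (val P i (algebraMap R (FractionRing R) (d * m))),
    fun h hh => ?_⟩
  have hint (i : Fin r) : val P i (h * e) ≤ 1 := by
    have hi := hh i
    rw [neg_neg, WithZero.exp_log (hR.val_algebraMap_ne_zero P (mul_mem hd hm) i)] at hi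
    calc val P i (h * e) ≤ val P i (algebraMap R (FractionRing R) (d * m) * e) := by
          rw [map_mul, map_mul]
          gcongr
      _ = 1 := by rw [he, map_one]
  obtain ⟨a, ha⟩ := hrange _ hint
  have hha : h = a • algebraMap R (FractionRing R) m := by
    rw [Algebra.linearMap_apply, Algebra.smul_def] at ha
    rw [map_mul] at he
    rw [Algebra.smul_def, ha]
    linear_combination -h * he
  exact hha ▸ Submodule.smul_mem _ a hmM

theorem isLattice (hR : IsCompleteAdmissible R)
    (hM : ∃ d ∈ R⁰, algebraMap R (FractionRing R) d ∈ M) :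
    IsLattice (val P) (M : Submodule R (FractionRing R)) :=
  ⟨hR.exists_subset_box P M, hR.exists_box_subset P M hM⟩

end IsCompleteAdmissible

end Lattices

end Colength

open Colength in
theorem theorem10 {R : Type*} [CommRing R] [IsLocalRing R] (hR : IsCompleteAdmissible R)
    {n : ℕ} (P : Fin (n + 1) ≃ minimalPrimes R)
    (M : FractionalIdeal (nonZeroDivisors R) (FractionRing R))
    (hM : ∃ d ∈ nonZeroDivisors R, algebraMap R (FractionRing R) d ∈ M) :
    ∃ α₀ c : Fin (n + 1) → ℤ,
      IsLeast (idealValueSet P M) α₀ ∧ IsConductor (idealValueSet P M) c ∧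
      ∀ γ : Fin (n + 1) → ℤ, c ≤ γ →
        colength P M γ ≠ ⊤ ∧
        projColength P M {Fin.last n}ᶜ (fun j => γ j) ≠ ⊤ ∧
        (gaps (branchValueSet P M (Fin.last n))).Finite ∧
        (relMaximalCoords (projValueSet P M) (Fin.last n)).Finite ∧
        ((colength P M γ).toNat : ℤ) =
          ((projColength P M {Fin.last n}ᶜ (fun j => γ j)).toNat : ℤ)
            + (γ (Fin.last n) - α₀ (Fin.last n))
            - ((gaps (branchValueSet P M (Fin.last n))).ncard : ℤ)
            - ((relMaximalCoords (projValueSet P M) (Fin.last n)).ncard : ℤ) := by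
  have := hR.isReduced
  have hw := hR.isBranchSystem P
  have hL := hR.isLattice P M hM
  obtain ⟨α₀, hα₀⟩ := hw.exists_isLeast_orderSet hL
  obtain ⟨c, hc⟩ := hw.exists_isConductor_orderSet hL
  set l := Fin.last n
  rw [idealValueSet_eq, branchValueSet_eq, funext (projValueSet_eq P M),
    relMaximalCoords_orderSet hw hL]
  refine ⟨α₀, c, hα₀, hc, fun γ hγ => ?_⟩
  have hbox := (box_antitone hγ).trans (hw.box_subset_of_Ici_subset_orderSet hL hc.1.2)
  have hleast := hw.isLeast_orders hL hα₀ l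
  have hsub := pureOrders_subset_orders (w := val P) (M := (M : Submodule R (FractionRing R))) l
  have hIci := hw.Ici_subset_pureOrders hbox l
  have hfin := finite_inter_Iio (g := γ l) hleast hsub
  have hproj := projColength_ne_top P M hw hL γ {l}ᶜ
  have hlength := colength_eq_encard_add_projColength P M hw hL hbox l
  refine ⟨?_, hproj, finite_gaps hleast (hIci.trans hsub),
    finite_diff_of_Ici_subset hleast hIci, ?_⟩
  · exact hlength ▸ WithTop.add_ne_top.mpr ⟨hfin.encard_lt_top.ne, hproj⟩
  · have hcount := ncard_gaps_add_ncard_diff_add_ncard hleast hsub hIci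
    rw [hlength, ENat.toNat_add hfin.encard_lt_top.ne hproj, Nat.cast_add, ← Set.ncard_def]
    linarith
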